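/- Let $L\ge 1$ and let $u$ be a real-valued global solution of the $2L$-periodic differentiated Kuramoto-Sivashinsky equation $$u_t+u_{xxxx}+u_{xx}+u\,u_x=0,\qquad u(t,x+2L)=u(t,x),\qquad u(0,\cdot)=u_0\in L^2(-L,L),$$ that is, $u\in C([0,\infty);L^2(-L,L))$ and the equation holds in the sense of distributions. For $1\le p\le\infty$ put $$H=\sup_{0\le t<\infty}\|u(t,\cdot)\|_{L^2(-L,L)},\qquad K_p=\sup_{0<t<\infty}\|u(t,\cdot)\|_{L^p(-L,L)}$$ (both in $[0,\infty]$). For $s\ge 0$ let $\|f\|_{H^s}=\|f\|_{L^2(-L,L)}+\bigl(\sum_{k\in\mathbb Z}|a_k|^2(|k|/L)^{2s}\bigr)^{1/2}$, where $a_k=(2L)^{-1/2}\int_{-L}^{L}f(x)e^{-\pi i kx/L}\,dx$. Then for every $s\ge 0$, $1\le p\le\infty$ and $\delta>0$ there is a constant $C_{s,p,\delta}$, depending only on $s$, $p$ and $\delta$ (in particular not on $L$ or $u$), such that $$\sup_{\delta\le t<\infty}\|u(t,\cdot)\|_{H^s}\le C_{s,p,\delta}\,\max(1,K_p)^{s/(3-1/p)}\,H,$$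 with the convention $1/\infty=0$. In particular, when $K_p\ge 1$, the right-hand side is $C_{s,p,\delta}K_p^{s/(3-1/p)}H$. -/

import Mathlib

open MeasureTheory Set Filter Topology
open scoped ENNReal NNReal ContDiff

namespace KuramotoSivashinsky

/-- One period `(-L, L]` with Lebesgue measure; the spaces `L^p(-L, L)` are taken over it. -/
noncomputable def periodMeasure (L : ℝ) : Measure ℝ :=
  volume.restrict (Ioc (-L) L)

/-- The norm `‖f‖_{L^p(-L, L)}`, with values in `[0, ∞]`. -/
noncomputable def periodNorm (L : ℝ) (p : ℝ≥0∞) (f : ℝ → ℝ) : ℝ≥0∞ :=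
  eLpNorm f p (periodMeasure L)

/-- The Fourier coefficient
`a_k = (2L)^{-1/2} ∫_{-L}^{L} f(x) e^{-π i k x / L} dx` of a `2L`-periodic function,
normalised so that `∑ |a_k|² = ‖f‖²_{L²(-L, L)}`. -/
noncomputable def fourierCoef (L : ℝ) (f : ℝ → ℝ) (k : ℤ) : ℂ :=
  (1 / Real.sqrt (2 * L) : ℝ) *
    ∫ x in (-L)..L, (f x : ℂ) * Complex.exp (-(Real.pi * Complex.I * k * x / L))

/-- The homogeneous Sobolev norm `(∑_k |a_k|² (|k|/L)^{2s})^{1/2}`, with values in `[0, ∞]`. -/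
noncomputable def homSobolevNorm (L s : ℝ) (f : ℝ → ℝ) : ℝ≥0∞ :=
  (∑' k : ℤ, ‖fourierCoef L f k‖ₑ ^ 2 *
    ENNReal.ofReal ((|(k : ℝ)| / L) ^ (2 * s))) ^ (1 / 2 : ℝ)

/-- The norm of `H^s = L² ∩ Ḣ^s`, with values in `[0, ∞]`. -/
noncomputable def sobolevNorm (L s : ℝ) (f : ℝ → ℝ) : ℝ≥0∞ :=
  periodNorm L 2 f + homSobolevNorm L s f

/-- `u` (a function of `t` and `x`, only `t ≥ 0` matters) is a global `2L`-periodic solution of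
`u_t + u_xxxx + u_xx + u u_x = 0` with initial value `u 0 ∈ L²(-L, L)`: it belongs to
`C([0, ∞); L²(-L, L))` and solves the equation in the sense of distributions, that is, after
multiplication by a smooth `2L`-periodic `ψ`, integration by parts in `x` (where
`u u_x = (u²/2)_x`), and integration in time. -/
structure IsSolution (L : ℝ) (u : ℝ → ℝ → ℝ) : Prop where
  periodic : ∀ t, 0 ≤ t → Function.Periodic (u t) (2 * L)
  memLp : ∀ t, 0 ≤ t → MemLp (u t) 2 (periodMeasure L)
  continuous : ∀ t, 0 ≤ t →
    Tendsto (fun τ => periodNorm L 2 (fun x => u τ x - u t x)) (𝓝[Ici 0] t) (𝓝 0)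
  equation : ∀ ψ : ℝ → ℝ, ContDiff ℝ ∞ ψ → Function.Periodic ψ (2 * L) →
    ∀ t, 0 ≤ t →
      (∫ x in (-L)..L, u t x * ψ x) - (∫ x in (-L)..L, u 0 x * ψ x) =
        ∫ τ in (0 : ℝ)..t, ∫ x in (-L)..L,
          (-(u τ x * iteratedDeriv 4 ψ x) - u τ x * iteratedDeriv 2 ψ x
            + (u τ x) ^ 2 / 2 * deriv ψ x)

/-- `H = sup_{0 ≤ t < ∞} ‖u(t)‖_{L²}`, with values in `[0, ∞]`. -/
noncomputable def energySup (L : ℝ) (u : ℝ → ℝ → ℝ) : ℝ≥0∞ :=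
  ⨆ t : ℝ, ⨆ _ : 0 ≤ t, periodNorm L 2 (u t)

/-- `K_p = sup_{0 < t < ∞} ‖u(t)‖_{L^p}`, with values in `[0, ∞]`. -/
noncomputable def periodNormSup (L : ℝ) (p : ℝ≥0∞) (u : ℝ → ℝ → ℝ) : ℝ≥0∞ :=
  ⨆ t : ℝ, ⨆ _ : 0 < t, periodNorm L p (u t)

end KuramotoSivashinsky

namespace KuramotoSivashinsky

/-! The estimate is a local smoothing argument at the scale dictated by the equation. Balancing
`u_t`, `u_xxxx` and `u u_x` gives, for an inverse length `R`, time `R⁻⁴` and amplitude `R³`, so an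
`L^p` norm scales like `R^(3 - 1/p)`. Choose `R = max(1, K_p)^(1/(3 - 1/p))`. In units of the length
`1/R` the solution then has `L^p` norm at most `1`, the destabilising term `u_xx` carries the
coefficient `R⁻² ≤ 1`, and the period has only become longer. Hence smoothing over a time of order
`R⁻⁴` should give `|u| ≲ R³`, `|∂^m u| ≲ R^(3+m)` and `‖∂^m u‖₂ ≲ R^m H`. Interpolating the last
bound between `m = 0` and `m = ⌈s⌉` yields `R^s H`.

Uniformity in `L` rests on `exists_kern_bounds`: the kernel of `∂_x^j e^{-r⁴(∂_x⁴ + ∂_x²)}` has sup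
norm `O(r^(-j-1))` and `L¹` norm `O(r^(-j))` for `r ≤ 1 ≤ L`. With Duhamel's formula this gives
`exists_norm_synth_le` (from `L^p` to `L^∞`, by a contraction for a time-weighted sup norm) and
then, by induction on the order, `exists_norm_synth_dmul_le` (sup bounds of derivatives). For the
`L²` bounds in `exists_sum_sq_dmul_le`, one factor of the square is put in `L^∞` and the other in
`L²`, and maximal regularity is applied mode by mode; this keeps the result linear in `H`.

These arguments live on Fourier coefficients. `spectralSolution` shows that a distributional
solution with finite `H` has rapidly decaying coefficients at positive times and satisfies Duhamel's
formula. That step is qualitative: its constants may depend on `L` and `u`, and they only justify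
exchanging sums and integrals and starting the contraction. -/

variable {L : ℝ}

/-! ### Fourier series on one period -/

/-- The frequency `ξ_k = π k / L`. -/
noncomputable def freq (L : ℝ) (k : ℤ) : ℝ := Real.pi * k / L

/-- The Fourier mode `e^{i ξ_k x}`. -/
noncomputable def wave (L : ℝ) (k : ℤ) (x : ℝ) : ℂ :=
  Complex.exp ((freq L k * x : ℝ) * Complex.I)

/-- The function with Fourier coefficients `c`. -/
noncomputable def synth (L : ℝ) (c : ℤ → ℂ) (x : ℝ) : ℂ := ∑' k, c k * wave L k x

/-- Fourier coefficients, normalised so that `f = ∑ (coef L f k) e^{i ξ_k x}`. -/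
noncomputable def coef (L : ℝ) (f : ℝ → ℂ) (k : ℤ) : ℂ :=
  ((2 * L)⁻¹ : ℝ) * ∫ x in (-L)..L, f x * wave L (-k) x

/-- Convolution of sequences indexed by `ℤ`. -/
noncomputable def conv (c d : ℤ → ℂ) (k : ℤ) : ℂ := ∑' j, c j * d (k - j)

lemma freq_add (k l : ℤ) : freq L (k + l) = freq L k + freq L l := by
  simp only [freq]; push_cast; ring

lemma freq_neg (k : ℤ) : freq L (-k) = -freq L k := by
  simp only [freq]; push_cast; ring

lemma freq_sub (k l : ℤ) : freq L (k - l) = freq L k - freq L l := by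
  simp only [freq]; push_cast; ring

lemma freq_zero : freq L 0 = 0 := by simp [freq]

lemma norm_wave (k : ℤ) (x : ℝ) : ‖wave L k x‖ = 1 := Complex.norm_exp_ofReal_mul_I _

lemma wave_add (k l : ℤ) (x : ℝ) : wave L (k + l) x = wave L k x * wave L l x := by
  rw [wave, wave, wave, ← Complex.exp_add, freq_add]; congr 1; push_cast; ring

lemma wave_zero (x : ℝ) : wave L 0 x = 1 := by simp [wave, freq_zero]

lemma wave_sub (k : ℤ) (x y : ℝ) : wave L k (x - y) = wave L k x * wave L (-k) y := by
  rw [wave, wave, wave, ← Complex.exp_add, freq_neg]; congr 1; push_cast; ring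

lemma continuous_wave (k : ℤ) : Continuous (wave L k) := by
  unfold wave; fun_prop

lemma wave_periodic (hL : 0 < L) (k : ℤ) : Function.Periodic (wave L k) (2 * L) := by
  intro x
  rw [wave, wave, Complex.exp_eq_exp_iff_exists_int]
  refine ⟨k, ?_⟩
  have : freq L k * (x + 2 * L) = freq L k * x + k * (2 * Real.pi) := by
    rw [freq]; field_simp
  rw [this]; push_cast; ring

lemma fourier_eq_wave (hL : 0 < L) (k : ℤ) (x : ℝ) :
    fourier k (x : AddCircle (L - -L)) = wave L k x := by
  rw [fourier_coe_apply, wave, freq]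
  congr 1
  push_cast
  have : (L : ℂ) ≠ 0 := by exact_mod_cast hL.ne'
  have h2 : (L : ℂ) - -L ≠ 0 := by rw [sub_neg_eq_add, ← two_mul]; simpa using this
  field_simp
  ring

lemma coef_eq_fourierCoeffOn (hL : 0 < L) (h : -L < L) (f : ℝ → ℂ) (k : ℤ) :
    coef L f k = fourierCoeffOn h f k := by
  rw [fourierCoeffOn_eq_integral, coef, Complex.real_smul]
  congr 1
  · norm_num; ring
  · refine intervalIntegral.integral_congr fun x _ => ?_
    simp only [fourier_eq_wave hL, smul_eq_mul, mul_comm]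

lemma hasSum_sq_coef (hL : 0 < L) {f : ℝ → ℂ} (hf : MemLp f 2 (periodMeasure L)) :
    HasSum (fun k => ‖coef L f k‖ ^ 2) ((2 * L)⁻¹ * ∫ x in (-L)..L, ‖f x‖ ^ 2) := by
  have h : -L < L := by linarith
  have := hasSum_sq_fourierCoeffOn h hf
  simp only [← coef_eq_fourierCoeffOn hL h] at this
  convert this using 1
  rw [smul_eq_mul]; congr 2; ring

lemma integral_wave (hL : 0 < L) (k : ℤ) :
    ∫ x in (-L)..L, wave L k x = if k = 0 then (2 * L : ℂ) else 0 := by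
  split_ifs with hk
  · subst hk; simp [wave_zero]; ring
  · have hf : freq L k ≠ 0 := by
      simp [freq, hk, hL.ne', Real.pi_ne_zero]
    have hc : (freq L k : ℂ) * Complex.I ≠ 0 := by
      simp [hf]
    have := integral_exp_mul_complex (a := -L) (b := L) hc
    have h2 : (fun x : ℝ => Complex.exp ((freq L k : ℂ) * Complex.I * x)) = wave L k := by
      funext x; rw [wave]; congr 1; push_cast; ring
    rw [h2] at this
    rw [this]
    have h3 : Complex.exp ((freq L k : ℂ) * Complex.I * L) = wave L k L := congrFun h2 L
    have h4 : Complex.exp ((freq L k : ℂ) * Complex.I * (-L : ℝ)) = wave L k (-L) :=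
      congrFun h2 (-L)
    have h5 : wave L k L = wave L k (-L) := by
      rw [← wave_periodic hL k (-L)]; congr 1; ring
    rw [h3, h4, h5, sub_self, zero_div]

lemma summable_synth {c : ℤ → ℂ} (hc : Summable fun k => ‖c k‖) (x : ℝ) :
    Summable fun k => c k * wave L k x :=
  Summable.of_norm (by simpa [norm_wave] using hc)

lemma continuous_synth {c : ℤ → ℂ} (hc : Summable fun k => ‖c k‖) : Continuous (synth L c) := by
  refine continuous_tsum (fun k => (continuous_wave k).const_mul _) hc fun k x => ?_
  simp [norm_wave]

lemma synth_periodic (hL : 0 < L) (c : ℤ → ℂ) : Function.Periodic (synth L c) (2 * L) := by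
  intro x; simp only [synth, wave_periodic hL _ x]

lemma norm_synth_le {c : ℤ → ℂ} (hc : Summable fun k => ‖c k‖) (x : ℝ) :
    ‖synth L c x‖ ≤ ∑' k, ‖c k‖ := by
  have : ∀ k, ‖c k * wave L k x‖ = ‖c k‖ := fun k => by simp [norm_wave]
  calc ‖synth L c x‖ ≤ ∑' k, ‖c k * wave L k x‖ :=
        norm_tsum_le_tsum_norm (by simpa only [this] using hc)
    _ = _ := by simp only [this]

/-- Integrating an absolutely convergent trigonometric series against a bounded
continuous function term by term. -/
lemma integral_mul_synth {c : ℤ → ℂ} (hc : Summable fun k => ‖c k‖)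
    {g : ℝ → ℂ} (hg : Continuous g) {B : ℝ} (hB : ∀ x, ‖g x‖ ≤ B) (a b : ℝ) :
    ∫ x in a..b, g x * synth L c x = ∑' k, c k * ∫ x in a..b, g x * wave L k x := by
  have h := intervalIntegral.hasSum_integral_of_dominated_convergence (μ := volume) (a := a)
    (b := b) (F := fun (k : ℤ) x => c k * (g x * wave L k x))
    (f := fun x => g x * synth L c x) (fun k _ => ‖c k‖ * B)
    (fun k => ((hg.mul (continuous_wave k)).const_mul _).aestronglyMeasurable)
    (fun k => Eventually.of_forall fun x _ => by
      rw [norm_mul, norm_mul, norm_wave, mul_one]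
      exact mul_le_mul_of_nonneg_left (hB x) (norm_nonneg _))
    (Eventually.of_forall fun x _ => hc.mul_right _) (by simp)
    (Eventually.of_forall fun x _ => by
      have := (summable_synth (L := L) hc x).hasSum.mul_left (g x)
      simpa only [synth, mul_left_comm] using this)
  rw [← h.tsum_eq]
  simp only [intervalIntegral.integral_const_mul]

lemma coef_synth (hL : 0 < L) {c : ℤ → ℂ} (hc : Summable fun k => ‖c k‖) (k : ℤ) :
    coef L (synth L c) k = c k := by
  have h := integral_mul_synth (L := L) hc (continuous_wave (L := L) (-k)) (B := 1)
    (fun x => (norm_wave _ x).le) (-L) L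
  have h2 : ∀ j, ∫ x in (-L)..L, wave L (-k) x * wave L j x
      = if j = k then (2 * L : ℂ) else 0 := by
    intro j
    simp only [← wave_add, integral_wave hL]
    congr 1
    simp only [eq_iff_iff]; omega
  simp only [h2, mul_ite, mul_zero, tsum_ite_eq] at h
  have hL' : (L : ℂ) ≠ 0 := by exact_mod_cast hL.ne'
  simp only [coef, mul_comm (synth L c _), h]
  push_cast
  field_simp

lemma isFiniteMeasure_periodMeasure (L : ℝ) : IsFiniteMeasure (periodMeasure L) := by
  unfold periodMeasure; infer_instance

lemma memLp_of_continuous {f : ℝ → ℂ} (hf : Continuous f) (p : ℝ≥0∞) :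
    MemLp f p (periodMeasure L) := by
  obtain ⟨C, hC⟩ := (isCompact_Icc (a := -L) (b := L)).exists_bound_of_continuousOn
    hf.continuousOn
  have := isFiniteMeasure_periodMeasure L
  refine MemLp.of_bound hf.aestronglyMeasurable C ?_
  refine (ae_restrict_iff' measurableSet_Ioc).2 (Eventually.of_forall fun x hx => ?_)
  exact hC x (Ioc_subset_Icc_self hx)

lemma hasSum_sq_synth (hL : 0 < L) {c : ℤ → ℂ} (hc : Summable fun k => ‖c k‖) :
    HasSum (fun k => ‖c k‖ ^ 2) ((2 * L)⁻¹ * ∫ x in (-L)..L, ‖synth L c x‖ ^ 2) := by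
  simpa only [coef_synth hL hc] using
    hasSum_sq_coef hL (memLp_of_continuous (continuous_synth (L := L) hc) 2)

lemma integrable_mul_wave {f : ℝ → ℂ} (hL : 0 < L) (hf : Integrable f (periodMeasure L)) (k : ℤ) :
    IntervalIntegrable (fun x => f x * wave L k x) volume (-L) L := by
  rw [intervalIntegrable_iff_integrableOn_Ioc_of_le (by linarith)]
  exact hf.mul_bdd (c := 1) (continuous_wave _).aestronglyMeasurable
    (Eventually.of_forall fun x => (norm_wave _ x).le)

lemma coef_sub {f g : ℝ → ℂ} (hL : 0 < L) (hf : Integrable f (periodMeasure L))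
    (hg : Integrable g (periodMeasure L)) (k : ℤ) :
    coef L (fun x => f x - g x) k = coef L f k - coef L g k := by
  simp only [coef, sub_mul]
  rw [intervalIntegral.integral_sub (integrable_mul_wave hL hf _) (integrable_mul_wave hL hg _),
    mul_sub]

lemma integrable_of_memLp_two {f : ℝ → ℂ} (hf : MemLp f 2 (periodMeasure L)) :
    Integrable f (periodMeasure L) :=
  have := isFiniteMeasure_periodMeasure L
  hf.integrable (by norm_num)

lemma coef_congr_ae {f g : ℝ → ℂ} (hL : 0 < L) (h : f =ᵐ[periodMeasure L] g) (k : ℤ) :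
    coef L f k = coef L g k := by
  rw [coef, coef, intervalIntegral.integral_of_le (by linarith),
    intervalIntegral.integral_of_le (by linarith)]
  congr 1
  refine integral_congr_ae ?_
  filter_upwards [h] with x hx
  rw [hx]

/-- An `L²` function with absolutely summable Fourier coefficients is the sum of its
Fourier series. -/
lemma ae_eq_synth_coef (hL : 0 < L) {f : ℝ → ℂ} (hf : MemLp f 2 (periodMeasure L))
    (hc : Summable fun k => ‖coef L f k‖) :
    f =ᵐ[periodMeasure L] synth L (coef L f) := by
  set g := synth L (coef L f)
  have hg : MemLp g 2 (periodMeasure L) := memLp_of_continuous (continuous_synth hc) 2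
  have h := hasSum_sq_coef hL (hf.sub hg)
  have h0 : ∀ k, coef L (f - g) k = 0 := fun k => by
    have := coef_sub hL (integrable_of_memLp_two hf) (integrable_of_memLp_two hg) k
    rw [coef_synth hL hc, sub_self] at this
    exact this
  simp only [h0, norm_zero, ne_eq, OfNat.ofNat_ne_zero, not_false_eq_true, zero_pow] at h
  have h1 := h.unique hasSum_zero
  have h2 : ∫ x in (-L)..L, ‖(f - g) x‖ ^ 2 = 0 := by
    rcases mul_eq_zero.1 h1 with h | h
    · exact absurd h (by positivity)
    · exact h
  rw [intervalIntegral.integral_of_le (by linarith)] at h2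
  change ∫ x, ‖(f - g) x‖ ^ 2 ∂(periodMeasure L) = 0 at h2
  rw [integral_eq_zero_iff_of_nonneg (fun x => by positivity) ((hf.sub hg).integrable_norm_pow
    (by norm_num))] at h2
  filter_upwards [h2] with x hx
  have : ‖f x - g x‖ ^ 2 = 0 := hx
  have := pow_eq_zero_iff (two_ne_zero) |>.1 this
  exact sub_eq_zero.1 (norm_eq_zero.1 this)

/-! ### Products of functions and convolution of coefficients -/

/-- The change of variables `(k, j) ↦ (j, k - j)`. -/
def convEquiv : ℤ × ℤ ≃ ℤ × ℤ where
  toFun z := (z.2, z.1 - z.2)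
  invFun z := (z.1 + z.2, z.1)
  left_inv z := by simp
  right_inv z := by simp

lemma summable_norm_mul_sub {c d : ℤ → ℂ} (hc : Summable fun k => ‖c k‖)
    (hd : Summable fun k => ‖d k‖) :
    Summable fun z : ℤ × ℤ => ‖c z.2‖ * ‖d (z.1 - z.2)‖ := by
  have h := hc.mul_of_nonneg hd (fun _ => norm_nonneg _) (fun _ => norm_nonneg _)
  exact (convEquiv.summable_iff (f := fun z : ℤ × ℤ => ‖c z.1‖ * ‖d z.2‖)).2 h

lemma summable_conv_term {c d : ℤ → ℂ} (hc : Summable fun k => ‖c k‖)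
    (hd : Summable fun k => ‖d k‖) (k : ℤ) : Summable fun j => c j * d (k - j) := by
  have := (summable_norm_mul_sub hc hd).prod_factor k
  exact Summable.of_norm (by simpa using this)

lemma summable_conv {c d : ℤ → ℂ} (hc : Summable fun k => ‖c k‖)
    (hd : Summable fun k => ‖d k‖) : Summable fun k => ‖conv c d k‖ := by
  have := (summable_norm_mul_sub hc hd)
  refine Summable.of_nonneg_of_le (fun _ => norm_nonneg _) (fun k => ?_) this.prod
  have h := this.prod_factor k
  simpa [conv] using norm_tsum_le_tsum_norm (f := fun j => c j * d (k - j)) (by simpa using h)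

lemma synth_conv {c d : ℤ → ℂ} (hc : Summable fun k => ‖c k‖)
    (hd : Summable fun k => ‖d k‖) (x : ℝ) :
    synth L (conv c d) x = synth L c x * synth L d x := by
  have h1 : Summable fun k => ‖c k * wave L k x‖ := by simpa [norm_wave] using hc
  have h2 : Summable fun k => ‖d k * wave L k x‖ := by simpa [norm_wave] using hd
  have h3 := convEquiv.summable_iff.2 (summable_mul_of_summable_norm h1 h2)
  have h4 : synth L c x * synth L d x =
      ∑' z : ℤ × ℤ, c (convEquiv z).1 * wave L (convEquiv z).1 x *
        (d (convEquiv z).2 * wave L (convEquiv z).2 x) := by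
    rw [synth, synth, tsum_mul_tsum_of_summable_norm h1 h2]
    exact (convEquiv.tsum_eq _).symm
  have h5 : ∀ k j : ℤ, wave L k x = wave L j x * wave L (k - j) x := fun k j => by
    rw [← wave_add, add_sub_cancel]
  rw [h4]
  refine Eq.trans ?_ (Summable.tsum_prod h3).symm
  refine tsum_congr fun k => ?_
  rw [conv, ← tsum_mul_right]
  refine tsum_congr fun j => ?_
  rw [h5 k j]
  simp only [convEquiv, Function.comp_apply, Equiv.coe_fn_mk]
  ring

lemma sum_sq_le_of_hasSum {f : ℤ → ℝ} {a : ℝ} (h : HasSum (fun k => f k ^ 2) a) (S : Finset ℤ) :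
    ∑ k ∈ S, f k ^ 2 ≤ a := sum_le_hasSum S (fun _ _ => sq_nonneg _) h

/-- Multiplication by a function bounded by `X` is bounded by `X` on `L²`. -/
lemma sum_sq_conv_le (hL : 0 < L) {c d : ℤ → ℂ} (hc : Summable fun k => ‖c k‖)
    (hd : Summable fun k => ‖d k‖) {X Y : ℝ} (hX : ∀ x, ‖synth L c x‖ ≤ X)
    (hY : ∀ S : Finset ℤ, ∑ k ∈ S, ‖d k‖ ^ 2 ≤ Y) (S : Finset ℤ) :
    ∑ k ∈ S, ‖conv c d k‖ ^ 2 ≤ X ^ 2 * Y := by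
  have h1 := hasSum_sq_synth hL (summable_conv hc hd)
  have h2 := hasSum_sq_synth hL hd
  refine (sum_sq_le_of_hasSum h1 S).trans ?_
  have h3 : _ ≤ Y := hasSum_le_of_sum_le h2 hY
  refine le_trans ?_ (mul_le_mul_of_nonneg_left h3 (sq_nonneg X))
  rw [mul_left_comm, ← intervalIntegral.integral_const_mul (X ^ 2)]
  refine mul_le_mul_of_nonneg_left ?_ (by positivity)
  refine intervalIntegral.integral_mono_on (by linarith)
    (((continuous_synth (summable_conv hc hd)).norm.pow 2).intervalIntegrable _ _)
    ((continuous_const.mul ((continuous_synth hd).norm.pow 2)).intervalIntegrable _ _) fun x _ => ?_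
  rw [synth_conv hc hd, norm_mul, mul_pow]
  have := hX x
  gcongr

/-! ### Estimates of the symbol and sums over the frequency lattice -/

/-- A quarter of the quartic absorbs the polynomial factor and the weight `1 + η ^ 2`; the remaining
three quarters dominate `a * η ^ 2` up to a constant. Here `a` stands for the rescaled coefficient
`r ^ 2` of `u_xx`, which is why uniformity on `[0, 1]` is needed. -/
lemma exists_pow_mul_exp_le (n : ℕ) : ∃ C : ℝ, 0 < C ∧ ∀ η a : ℝ, 0 ≤ a → a ≤ 1 →
    |η| ^ n * Real.exp (a * η ^ 2 - η ^ 4) ≤ C / (1 + η ^ 2) := by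
  have key : ∀ n : ℕ, ∃ C : ℝ, 0 < C ∧ ∀ η : ℝ, |η| ^ n ≤ C * Real.exp (η ^ 4 / 4) := by
    intro n
    refine ⟨1 + 4 ^ n * n.factorial, by positivity, fun η => ?_⟩
    have h1 : |η| ^ n ≤ 1 + (η ^ 4) ^ n := by
      rcases le_total (|η|) 1 with h | h
      · have := pow_le_one₀ (n := n) (abs_nonneg η) h
        have : 0 ≤ (η ^ 4) ^ n := by positivity
        linarith
      · have h2 : |η| ^ n ≤ |η| ^ (4 * n) := pow_le_pow_right₀ h (by omega)
        have h3 : |η| ^ (4 * n) = (η ^ 4) ^ n := by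
          rw [pow_mul, Even.pow_abs (by decide)]
        linarith
    have h2 := Real.pow_div_factorial_le_exp (x := η ^ 4 / 4) (by positivity) n
    have h3 : 1 ≤ Real.exp (η ^ 4 / 4) := Real.one_le_exp (by positivity)
    have h4 : (η ^ 4) ^ n = 4 ^ n * n.factorial * ((η ^ 4 / 4) ^ n / n.factorial) := by
      rw [div_pow]; field_simp
    rw [h4] at h1
    have h5 : (4 : ℝ) ^ n * n.factorial * ((η ^ 4 / 4) ^ n / n.factorial) ≤
        4 ^ n * n.factorial * Real.exp (η ^ 4 / 4) :=
      mul_le_mul_of_nonneg_left h2 (by positivity)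
    linarith
  obtain ⟨C1, hC1, h1⟩ := key n
  obtain ⟨C2, hC2, h2⟩ := key (n + 2)
  refine ⟨(C1 + C2) * Real.exp 1, by positivity, fun η a ha ha1 => ?_⟩
  rw [le_div_iff₀ (by positivity)]
  have h3 : |η| ^ n * (1 + η ^ 2) ≤ (C1 + C2) * Real.exp (η ^ 4 / 4) := by
    have := h1 η
    have := h2 η
    have h4 : |η| ^ (n + 2) = |η| ^ n * η ^ 2 := by rw [pow_add, sq_abs]
    nlinarith
  have h4 : Real.exp (η ^ 4 / 4) * Real.exp (a * η ^ 2 - η ^ 4) ≤ Real.exp 1 := by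
    rw [← Real.exp_add]
    refine Real.exp_le_exp.2 ?_
    nlinarith [sq_nonneg (η ^ 2 - 1), sq_nonneg η, sq_nonneg (η ^ 2)]
  calc |η| ^ n * Real.exp (a * η ^ 2 - η ^ 4) * (1 + η ^ 2)
      = (|η| ^ n * (1 + η ^ 2)) * Real.exp (a * η ^ 2 - η ^ 4) := by ring
    _ ≤ ((C1 + C2) * Real.exp (η ^ 4 / 4)) * Real.exp (a * η ^ 2 - η ^ 4) := by gcongr
    _ = (C1 + C2) * (Real.exp (η ^ 4 / 4) * Real.exp (a * η ^ 2 - η ^ 4)) := by ring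
    _ ≤ _ := by gcongr

/-- The rescaled Fourier symbol of the linear evolution is Lipschitz with an integrable weight. -/
lemma exists_symbol_sub_le (j : ℕ) : ∃ C : ℝ, 0 < C ∧ ∀ x y a : ℝ, 0 ≤ a → a ≤ 1 →
    |y - x| ≤ Real.pi →
    |y ^ j * Real.exp (a * y ^ 2 - y ^ 4) - x ^ j * Real.exp (a * x ^ 2 - x ^ 4)| ≤
      C * |y - x| / (1 + x ^ 2) := by
  -- The three exponents are those in the derivative of the symbol. For `j = 0` the truncated `j -
  -- 1` is harmless, since that term carries the factor `j`.
  obtain ⟨C1, hC1, h1⟩ := exists_pow_mul_exp_le (j - 1)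
  obtain ⟨C2, hC2, h2⟩ := exists_pow_mul_exp_le (j + 1)
  obtain ⟨C3, hC3, h3⟩ := exists_pow_mul_exp_le (j + 3)
  set M := j * C1 + 2 * C2 + 4 * C3
  have hM : 0 < M := by positivity
  refine ⟨M * (2 + 2 * Real.pi ^ 2), by positivity, fun x y a ha ha1 hxy => ?_⟩
  have hd : ∀ z : ℝ, HasDerivAt (fun z : ℝ => z ^ j * Real.exp (a * z ^ 2 - z ^ 4))
      (j * z ^ (j - 1) * Real.exp (a * z ^ 2 - z ^ 4) +
        z ^ j * (Real.exp (a * z ^ 2 - z ^ 4) * (a * (2 * z) - 4 * z ^ 3))) z := by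
    intro z
    have := (hasDerivAt_pow j z).mul
      ((((hasDerivAt_pow 2 z).const_mul a).sub (hasDerivAt_pow 4 z)).exp)
    refine this.congr_deriv ?_
    simp only [Pi.sub_apply]
    norm_num
  have hb : ∀ z ∈ uIcc x y, ‖j * z ^ (j - 1) * Real.exp (a * z ^ 2 - z ^ 4) +
        z ^ j * (Real.exp (a * z ^ 2 - z ^ 4) * (a * (2 * z) - 4 * z ^ 3))‖ ≤
        M * (2 + 2 * Real.pi ^ 2) / (1 + x ^ 2) := by
    intro z hz
    set E := Real.exp (a * z ^ 2 - z ^ 4) with hE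
    have hE0 : 0 < E := Real.exp_pos _
    have e1 : ‖j * z ^ (j - 1) * E + z ^ j * (E * (a * (2 * z) - 4 * z ^ 3))‖ ≤
        j * (|z| ^ (j - 1) * E) + 2 * (|z| ^ (j + 1) * E) + 4 * (|z| ^ (j + 3) * E) := by
      have : j * z ^ (j - 1) * E + z ^ j * (E * (a * (2 * z) - 4 * z ^ 3)) =
          j * z ^ (j - 1) * E + a * (2 * z ^ (j + 1) * E) - 4 * z ^ (j + 3) * E := by ring
      rw [this]
      refine (norm_sub_le _ _).trans (add_le_add ((norm_add_le _ _).trans (add_le_add ?_ ?_)) ?_)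
      · simp [abs_of_pos hE0, mul_assoc]
      · rw [Real.norm_eq_abs, abs_mul, abs_of_nonneg ha]
        refine (mul_le_of_le_one_left (abs_nonneg _) ha1).trans ?_
        simp [abs_mul, abs_pow, abs_of_pos hE0, mul_assoc]
      · simp [abs_of_pos hE0, mul_assoc]
    have e2 : j * (|z| ^ (j - 1) * E) + 2 * (|z| ^ (j + 1) * E) + 4 * (|z| ^ (j + 3) * E) ≤
        M / (1 + z ^ 2) := by
      have := h1 z a ha ha1
      have := h2 z a ha ha1
      have := h3 z a ha ha1
      calc _ ≤ j * (C1 / (1 + z ^ 2)) + 2 * (C2 / (1 + z ^ 2)) + 4 * (C3 / (1 + z ^ 2)) := by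
            gcongr
        _ = _ := by simp only [M]; ring
    refine (e1.trans e2).trans ?_
    rw [div_le_div_iff₀ (by positivity) (by positivity), mul_assoc]
    refine mul_le_mul_of_nonneg_left ?_ hM.le
    -- The restriction to steps of length at most `π` makes the weights at `z` and at `x`
    -- comparable, with ratio at most `2 + 2π²`.
    have h4 : |z - x| ≤ Real.pi := (abs_sub_left_of_mem_uIcc hz).trans hxy
    have h5 : (z - x) ^ 2 ≤ Real.pi ^ 2 := by
      rw [← sq_abs]; gcongr
    nlinarith [sq_nonneg (z - x), sq_nonneg (z + (z - x)), Real.pi_pos,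
      mul_nonneg (sq_nonneg z) (sq_nonneg Real.pi)]
  have := Convex.norm_image_sub_le_of_norm_hasDerivWithin_le
    (fun z _ => (hd z).hasDerivWithinAt) hb (convex_uIcc x y) left_mem_uIcc right_mem_uIcc
  rw [Real.norm_eq_abs, Real.norm_eq_abs] at this
  refine this.trans (le_of_eq ?_)
  ring

lemma mul_inv_one_add_sq_le {h x : ℝ} (hh : 0 < h) (hx : 0 ≤ x) :
    h * (1 / (1 + (x + h) ^ 2)) ≤ Real.arctan (x + h) - Real.arctan x := by
  have := integral_one_div_one_add_sq (a := x) (b := x + h)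
  rw [← this]
  have h2 : ∫ _ in x..(x + h), (1 / (1 + (x + h) ^ 2)) = h * (1 / (1 + (x + h) ^ 2)) := by
    rw [intervalIntegral.integral_const]; simp
  rw [← h2]
  refine intervalIntegral.integral_mono_on (by linarith) (by simp)
    (Continuous.intervalIntegrable ?_ _ _) fun y hy => ?_
  · refine continuous_const.div (by fun_prop) fun y => by positivity
  · have : 0 ≤ y := hx.trans hy.1
    have := hy.2
    gcongr

/-- Comparison with the integral of `1/(1 + x²)`: with spacing `h = rπ/L`, each half-line
contributes at most `(π/2)/h = L/(2r)`. The term `k = 0` equals `1 ≤ L/r`, which is where `r ≤ 1 ≤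
L` enters. -/
lemma lattice_sum {r : ℝ} (hL : 1 ≤ L) (hr : 0 < r) (hr1 : r ≤ 1) :
    Summable (fun k : ℤ => 1 / (1 + (r * freq L k) ^ 2)) ∧
      ∑' k : ℤ, 1 / (1 + (r * freq L k) ^ 2) ≤ 2 * L / r := by
  have hL0 : 0 < L := by linarith
  set h := r * Real.pi / L with hh
  have h0 : 0 < h := by have := Real.pi_pos; positivity
  have hf : ∀ k : ℤ, r * freq L k = h * k := fun k => by rw [hh, freq]; ring
  simp only [hf]
  set f : ℤ → ℝ := fun k => 1 / (1 + (h * k) ^ 2) with hfd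
  have hfn : ∀ k, 0 ≤ f k := fun k => by positivity
  have hN : ∀ N : ℕ, ∑ n ∈ Finset.range N, f (n + 1) ≤ Real.pi / 2 / h := by
    intro N
    rw [le_div_iff₀ h0, mul_comm, Finset.mul_sum]
    refine le_trans ?_ (Real.arctan_lt_pi_div_two (h * N)).le
    have : ∀ n ∈ Finset.range N, h * f (n + 1) ≤
        Real.arctan (h * ((n + 1 : ℕ) : ℝ)) - Real.arctan (h * (n : ℝ)) := by
      intro n _
      have := mul_inv_one_add_sq_le h0 (x := h * n) (by positivity)
      simp only [hfd]
      push_cast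
      rw [mul_add, mul_one]
      exact this
    refine (Finset.sum_le_sum this).trans ?_
    rw [Finset.sum_range_sub (fun n : ℕ => Real.arctan (h * (n : ℝ)))]
    simp
  have hs1 : Summable fun n : ℕ => f (n + 1) :=
    summable_of_sum_range_le (fun _ => hfn _) hN
  have ht1 : ∑' n : ℕ, f (n + 1) ≤ Real.pi / 2 / h :=
    Real.tsum_le_of_sum_range_le (fun _ => hfn _) hN
  have hneg : ∀ n : ℕ, f (-(n + 1 : ℤ)) = f (n + 1) := fun n => by
    simp only [hfd]; push_cast; ring
  have hs0 : Summable fun n : ℕ => f n := by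
    refine (summable_nat_add_iff 1).1 ?_
    simpa using hs1
  have hs2 : Summable fun n : ℕ => f (-(n + 1 : ℤ)) := by simpa only [hneg] using hs1
  refine ⟨Summable.of_nat_of_neg_add_one hs0 hs2, ?_⟩
  rw [tsum_of_nat_of_neg_add_one hs0 hs2, hs0.tsum_eq_zero_add]
  simp only [hneg]
  push_cast
  have h00 : f 0 = 1 := by simp [hfd]
  have hval : Real.pi / 2 / h = L / r / 2 := by
    rw [hh]; have := Real.pi_pos; field_simp
  rw [hval] at ht1
  have : 1 ≤ L / r := by rw [le_div_iff₀ hr]; linarith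
  rw [h00]
  have : 2 * L / r = L / r + L / r := by ring
  linarith

/-- Size of a trigonometric series whose coefficients live at frequencies `≲ 1 / r`. -/
lemma synth_bounds_of_norm_le {r B : ℝ} (hL : 1 ≤ L) (hr : 0 < r) (hr1 : r ≤ 1)
    {c : ℤ → ℂ} (hB : 0 ≤ B) (hc : ∀ k, ‖c k‖ ≤ B * (1 / (1 + (r * freq L k) ^ 2))) :
    Summable (fun k => ‖c k‖) ∧ (∀ x, ‖((2 * L)⁻¹ : ℝ) * synth L c x‖ ≤ B / r) ∧
      ∫ x in (-L)..L, ‖((2 * L)⁻¹ : ℝ) * synth L c x‖ ^ 2 ≤ B ^ 2 / r := by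
  obtain ⟨hs, ht⟩ := lattice_sum (L := L) hL hr hr1
  have hL0 : 0 < L := by linarith
  have hcs : Summable fun k => ‖c k‖ :=
    Summable.of_nonneg_of_le (fun _ => norm_nonneg _) hc (hs.mul_left B)
  have hn : ‖(((2 * L)⁻¹ : ℝ) : ℂ)‖ = (2 * L)⁻¹ := by
    rw [Complex.norm_real, Real.norm_of_nonneg (by positivity)]
  refine ⟨hcs, fun x => ?_, ?_⟩
  · rw [norm_mul, hn]
    have h1 : ‖synth L c x‖ ≤ B * (2 * L / r) := by
      refine (norm_synth_le hcs x).trans ((hcs.tsum_le_tsum hc (hs.mul_left B)).trans ?_)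
      rw [tsum_mul_left]
      gcongr
    -- The number `2L/r` of effective modes cancels against the normalisation `1/(2L)`, so no
    -- dependence on the period survives.
    calc (2 * L)⁻¹ * ‖synth L c x‖ ≤ (2 * L)⁻¹ * (B * (2 * L / r)) := by gcongr
      _ = B / r := by field_simp
  · have h1 := hasSum_sq_synth hL0 hcs
    have h2 : (2 * L)⁻¹ * ∫ x in (-L)..L, ‖synth L c x‖ ^ 2 ≤ B ^ 2 * (2 * L / r) := by
      refine (hasSum_le (fun k => ?_) h1 (hs.hasSum.mul_left (B ^ 2))).trans ?_
      · have h3 : (0 : ℝ) < 1 / (1 + (r * freq L k) ^ 2) := by positivity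
        have h4 : 1 / (1 + (r * freq L k) ^ 2) ≤ 1 := by
          rw [div_le_one (by positivity)]; nlinarith [sq_nonneg (r * freq L k)]
        calc ‖c k‖ ^ 2 ≤ (B * (1 / (1 + (r * freq L k) ^ 2))) ^ 2 := by
              have := hc k; gcongr
          _ = B ^ 2 * ((1 / (1 + (r * freq L k) ^ 2)) * (1 / (1 + (r * freq L k) ^ 2))) := by ring
          _ ≤ B ^ 2 * ((1 / (1 + (r * freq L k) ^ 2)) * 1) := by gcongr
          _ = _ := by ring
      · gcongr
    simp only [norm_mul, hn, mul_pow]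
    rw [intervalIntegral.integral_const_mul]
    calc ((2 * L)⁻¹) ^ 2 * ∫ x in (-L)..L, ‖synth L c x‖ ^ 2
        = (2 * L)⁻¹ * ((2 * L)⁻¹ * ∫ x in (-L)..L, ‖synth L c x‖ ^ 2) := by ring
      _ ≤ (2 * L)⁻¹ * (B ^ 2 * (2 * L / r)) := by gcongr
      _ = B ^ 2 / r := by field_simp

/-! ### The kernel of the linear evolution -/

/-- The exponential rate at which the linear equation damps the mode `k`. -/
noncomputable def rate (L : ℝ) (k : ℤ) : ℝ := freq L k ^ 4 - freq L k ^ 2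

/-- Fourier multiplier of `∂_x^j e^{-r⁴ (∂_x⁴ + ∂_x²)}`. -/
noncomputable def symb (L : ℝ) (j : ℕ) (r : ℝ) (k : ℤ) : ℂ :=
  (Complex.I * freq L k) ^ j * (Real.exp (-(r ^ 4 * rate L k)) : ℝ)

/-- Convolution kernel of `∂_x^j e^{-r⁴ (∂_x⁴ + ∂_x²)}`. -/
noncomputable def kern (L : ℝ) (j : ℕ) (r : ℝ) (x : ℝ) : ℂ :=
  ((2 * L)⁻¹ : ℝ) * synth L (symb L j r) x

/-- In the variable `η = rξ` the exponent is `r²η² - η⁴`, with a coefficient `r²` in `[0, 1]` when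
`r ≤ 1`. All symbols thus have profiles covered by the uniform bounds above, and the `j` derivatives
cost `r^(-j)`. -/
lemma symb_eq (j : ℕ) {r : ℝ} (hr : 0 < r) (k : ℤ) : symb L j r k =
    (Complex.I ^ j / (r : ℂ) ^ j) * ((r * freq L k) ^ j *
      Real.exp (r ^ 2 * (r * freq L k) ^ 2 - (r * freq L k) ^ 4) : ℝ) := by
  have h : -(r ^ 4 * rate L k) = r ^ 2 * (r * freq L k) ^ 2 - (r * freq L k) ^ 4 := by
    rw [rate]; ring
  have hr' : (r : ℂ) ≠ 0 := by exact_mod_cast hr.ne'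
  rw [symb, h]
  push_cast
  field_simp
  ring

lemma norm_symb (j : ℕ) {r : ℝ} (hr : 0 < r) (k : ℤ) : ‖symb L j r k‖ =
    (|r * freq L k| ^ j *
      Real.exp (r ^ 2 * (r * freq L k) ^ 2 - (r * freq L k) ^ 4)) / r ^ j := by
  rw [symb_eq j hr, norm_mul, Complex.norm_real, norm_div, norm_pow, norm_pow, Complex.norm_I,
    Complex.norm_real, Real.norm_of_nonneg hr.le, Real.norm_eq_abs, abs_mul, abs_pow, Real.abs_exp]
  ring

lemma exists_norm_symb_le (j : ℕ) : ∃ C : ℝ, 0 < C ∧ ∀ L r : ℝ, 0 < r → r ≤ 1 → ∀ k : ℤ,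
    ‖symb L j r k‖ ≤ C / r ^ j * (1 / (1 + (r * freq L k) ^ 2)) := by
  obtain ⟨C, hC, h⟩ := exists_pow_mul_exp_le j
  refine ⟨C, hC, fun L r hr hr1 k => ?_⟩
  rw [norm_symb j hr]
  have := h (r * freq L k) (r ^ 2) (by positivity) (pow_le_one₀ hr.le hr1)
  calc _ ≤ (C / (1 + (r * freq L k) ^ 2)) / r ^ j := by gcongr
    _ = _ := by ring

/-- Neighbouring rescaled frequencies differ by `rπ/L ≤ π`, so the Lipschitz bound for the profile
applies and gains this factor. -/
lemma exists_norm_symb_sub_le (j : ℕ) : ∃ C : ℝ, 0 < C ∧ ∀ L r : ℝ, 1 ≤ L → 0 < r → r ≤ 1 →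
    ∀ k : ℤ, ‖symb L j r (k - 1) - symb L j r k‖ ≤
      C / r ^ j * (r * (Real.pi / L)) * (1 / (1 + (r * freq L k) ^ 2)) := by
  obtain ⟨C, hC, h⟩ := exists_symbol_sub_le j
  refine ⟨C, hC, fun L r hL hr hr1 k => ?_⟩
  have hd : r * freq L (k - 1) - r * freq L k = -(r * (Real.pi / L)) := by
    rw [freq, freq]; push_cast; ring
  have hpos : 0 < r * (Real.pi / L) := by have := Real.pi_pos; positivity
  have hle : r * (Real.pi / L) ≤ Real.pi := by
    have h1 : Real.pi / L ≤ Real.pi := div_le_self Real.pi_pos.le hL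
    have h2 : 0 < Real.pi / L := by have := Real.pi_pos; positivity
    nlinarith
  have := h (r * freq L k) (r * freq L (k - 1)) (r ^ 2) (by positivity) (pow_le_one₀ hr.le hr1)
    (by rw [hd, abs_neg, abs_of_pos hpos]; exact hle)
  rw [hd, abs_neg, abs_of_pos hpos] at this
  rw [symb_eq j hr, symb_eq j hr, ← mul_sub, ← Complex.ofReal_sub, norm_mul, Complex.norm_real,
    norm_div, norm_pow, norm_pow, Complex.norm_I, Complex.norm_real, Real.norm_of_nonneg hr.le,
    one_pow, Real.norm_eq_abs]
  calc _ ≤ 1 / r ^ j * (C * (r * (Real.pi / L)) / (1 + (r * freq L k) ^ 2)) := by gcongr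
    _ = _ := by ring

lemma summable_symb (hL : 1 ≤ L) (j : ℕ) {r : ℝ} (hr : 0 < r) (hr1 : r ≤ 1) :
    Summable fun k => ‖symb L j r k‖ := by
  obtain ⟨C, hC, h⟩ := exists_norm_symb_le j
  exact (synth_bounds_of_norm_le hL hr hr1 (by positivity) (h L r hr hr1)).1

lemma continuous_kern (hL : 1 ≤ L) (j : ℕ) {r : ℝ} (hr : 0 < r) (hr1 : r ≤ 1) :
    Continuous (kern L j r) :=
  continuous_const.mul (continuous_synth (summable_symb hL j hr hr1))

/-- Periodic substitute for the rule that differentiating the symbol multiplies the kernel by `x`: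
differences of coefficients correspond to the periodic weight `e^{iπx/L} - 1`. -/
lemma synth_shift_sub {c : ℤ → ℂ} (hc : Summable fun k => ‖c k‖) (x : ℝ) :
    synth L (fun k => c (k - 1) - c k) x = (wave L 1 x - 1) * synth L c x := by
  have h1 : Summable fun k => ‖c (k - 1)‖ :=
    ((Equiv.subRight (1 : ℤ)).summable_iff (f := fun k => ‖c k‖)).2 hc
  have h2 := (summable_synth (L := L) h1 x)
  have h3 := (summable_synth (L := L) hc x)
  simp only [synth, sub_mul, one_mul]
  rw [h2.tsum_sub h3, ← tsum_mul_left]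
  congr 1
  rw [← (Equiv.addRight (1 : ℤ)).tsum_eq]
  refine tsum_congr fun k => ?_
  simp only [Equiv.coe_addRight, add_sub_cancel_right, wave_add]
  ring

/-- Jordan's inequality for the sine: `|e^{iθ} - 1| = 2|sin(θ/2)|` with `θ = πx/L` is at least
`2|x|/L` on one period. -/
lemma sq_le_norm_wave_sub_one (hL : 0 < L) {x : ℝ} (hx : x ∈ Icc (-L) L) :
    x ^ 2 ≤ L ^ 2 / 4 * ‖wave L 1 x - 1‖ ^ 2 := by
  have h1 : wave L 1 x - 1 = Complex.exp (Complex.I * (freq L 1 * x : ℝ)) - 1 := by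
    rw [wave, mul_comm]
  rw [h1, Complex.norm_exp_I_mul_ofReal_sub_one]
  have h2 : |freq L 1 * x / 2| ≤ Real.pi / 2 := by
    have h3 : |x| ≤ L := abs_le.2 hx
    have h4 : freq L 1 * x / 2 = Real.pi / 2 * (x / L) := by rw [freq]; push_cast; ring
    rw [h4, abs_mul, abs_div x, abs_of_pos hL,
      abs_of_pos (by have := Real.pi_pos; positivity : 0 < Real.pi / 2)]
    refine mul_le_of_le_one_right (by have := Real.pi_pos; positivity) ?_
    rwa [div_le_one hL]
  have h3 := Real.mul_abs_le_abs_sin h2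
  have h4 : 2 / Real.pi * |freq L 1 * x / 2| = |x| / L := by
    rw [freq, abs_div, abs_mul, abs_div, abs_of_pos hL]
    simp only [Int.cast_one, mul_one, abs_of_pos Real.pi_pos, Nat.abs_ofNat]
    have := Real.pi_pos
    field_simp
  rw [h4] at h3
  have h5 : (|x| / L) ^ 2 ≤ |Real.sin (freq L 1 * x / 2)| ^ 2 := by gcongr
  rw [div_pow, sq_abs, sq_abs, div_le_iff₀ (by positivity)] at h5
  rw [Real.norm_eq_abs, sq_abs, mul_pow]
  nlinarith

lemma integral_inv_weight_le {r : ℝ} (hr : 0 < r) :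
    ∫ x in (-L)..L, (1 + x ^ 2 / r ^ 2)⁻¹ ≤ Real.pi * r := by
  have h : ∫ x in (-L)..L, (1 + (x / r) ^ 2)⁻¹ = r • ∫ x in (-L / r)..(L / r), (1 + x ^ 2)⁻¹ := by
    rw [intervalIntegral.integral_comp_div (fun x => (1 + x ^ 2)⁻¹) hr.ne']
  simp only [div_pow] at h
  rw [h, integral_inv_one_add_sq, smul_eq_mul, mul_comm]
  refine mul_le_mul_of_nonneg_right ?_ hr.le
  have h1 := Real.arctan_lt_pi_div_two (L / r)
  have h2 := Real.neg_pi_div_two_lt_arctan (-L / r)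
  linarith

/-- Pointwise and `L¹` bounds for the derivatives of the kernel of the linear evolution, uniform
in the period. -/
theorem exists_kern_bounds (j : ℕ) : ∃ A : ℝ, 0 < A ∧ ∀ L r : ℝ, 1 ≤ L → 0 < r → r ≤ 1 →
    (∀ x, ‖kern L j r x‖ ≤ A / r ^ (j + 1)) ∧ ∫ x in (-L)..L, ‖kern L j r x‖ ≤ A / r ^ j := by
  obtain ⟨C, hC, h1⟩ := exists_norm_symb_le j
  obtain ⟨D, hD, h2⟩ := exists_norm_symb_sub_le j
  set Q := C ^ 2 + Real.pi ^ 2 * D ^ 2 / 4 + Real.pi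
  have hpi := Real.pi_pos
  have hQ : 0 < Q := by positivity
  refine ⟨C + Q, by positivity, fun L r hL hr hr1 => ?_⟩
  have hL0 : 0 < L := by linarith
  obtain ⟨hs, hb, he⟩ := synth_bounds_of_norm_le hL hr hr1 (by positivity) (h1 L r hr hr1)
  obtain ⟨-, -, he2⟩ := synth_bounds_of_norm_le hL hr hr1 (by positivity) (h2 L r hL hr hr1)
  refine ⟨fun x => (hb x).trans ?_, ?_⟩
  · rw [div_div, ← pow_succ]; gcongr; linarith
  have hpow : r ^ (2 * j + 1) = (r ^ j) ^ 2 * r := by rw [pow_succ, pow_mul']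
  have hcont := continuous_kern hL j hr hr1
  have hw : Continuous fun x : ℝ => 1 + x ^ 2 / r ^ 2 := by fun_prop
  have hw0 : ∀ x : ℝ, 0 < 1 + x ^ 2 / r ^ 2 := fun x => by positivity
  have hwi : Continuous fun x : ℝ => (1 + x ^ 2 / r ^ 2)⁻¹ := hw.inv₀ fun x => (hw0 x).ne'
  have hkk : ∀ x, ‖((2 * L)⁻¹ : ℝ) * synth L (fun k => symb L j r (k - 1) - symb L j r k) x‖ =
      ‖wave L 1 x - 1‖ * ‖kern L j r x‖ := by
    intro x
    rw [synth_shift_sub hs, mul_left_comm, norm_mul]; rfl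
  simp only [hkk, mul_pow] at he2
  have hw1 : Continuous fun x => ‖wave L 1 x - 1‖ ^ 2 :=
    ((continuous_wave 1).sub continuous_const).norm.pow 2
  -- Weighted Plancherel. The factor `L²` lost in replacing `x²` by the periodic weight is recovered
  -- from `(π/L)²` in the differences of the symbol.
  have hx2 : ∫ x in (-L)..L, (1 + x ^ 2 / r ^ 2) * ‖kern L j r x‖ ^ 2 ≤
      (C ^ 2 + Real.pi ^ 2 * D ^ 2 / 4) / r ^ (2 * j + 1) := by
    have hm : ∫ x in (-L)..L, (1 + x ^ 2 / r ^ 2) * ‖kern L j r x‖ ^ 2 ≤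
        ∫ x in (-L)..L, (‖kern L j r x‖ ^ 2 +
          (L ^ 2 / 4 / r ^ 2) * (‖wave L 1 x - 1‖ ^ 2 * ‖kern L j r x‖ ^ 2)) := by
      refine intervalIntegral.integral_mono_on (by linarith)
        ((hw.mul (hcont.norm.pow 2)).intervalIntegrable _ _)
        (((hcont.norm.pow 2).add (continuous_const.mul
          (hw1.mul (hcont.norm.pow 2)))).intervalIntegrable _ _) fun x hx => ?_
      have := sq_le_norm_wave_sub_one hL0 hx
      calc (1 + x ^ 2 / r ^ 2) * ‖kern L j r x‖ ^ 2
          ≤ (1 + (L ^ 2 / 4 * ‖wave L 1 x - 1‖ ^ 2) / r ^ 2) * ‖kern L j r x‖ ^ 2 := by gcongr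
        _ = _ := by ring
    refine hm.trans ?_
    rw [intervalIntegral.integral_add
      (Continuous.intervalIntegrable (by fun_prop) _ _)
      (Continuous.intervalIntegrable (by fun_prop) _ _),
      intervalIntegral.integral_const_mul]
    calc _ ≤ (C / r ^ j) ^ 2 / r + L ^ 2 / 4 / r ^ 2 *
          ((D / r ^ j) ^ 2 * (r ^ 2 * (Real.pi / L) ^ 2) / r) := add_le_add he (by gcongr)
      _ = _ := by rw [hpow]; field_simp
  -- A pointwise form of Cauchy–Schwarz, `y ≤ q y² + q⁻¹`. The factor `r^(j+1)` in `q` makes both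
  -- resulting integrals of order `r^(-j)`.
  have hfin : ∫ x in (-L)..L, ‖kern L j r x‖ ≤
      ∫ x in (-L)..L, (r ^ (j + 1) * ((1 + x ^ 2 / r ^ 2) * ‖kern L j r x‖ ^ 2) +
        (r ^ (j + 1))⁻¹ * (1 + x ^ 2 / r ^ 2)⁻¹) := by
    refine intervalIntegral.integral_mono_on (by linarith) (hcont.norm.intervalIntegrable _ _)
      (((continuous_const.mul (hw.mul (hcont.norm.pow 2))).add
        (continuous_const.mul hwi)).intervalIntegrable _ _) fun x _ => ?_
    have ha := hw0 x
    set y := ‖kern L j r x‖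
    set q := r ^ (j + 1) * (1 + x ^ 2 / r ^ 2) with hq
    have hq0 : 0 < q := by positivity
    have e1 : r ^ (j + 1) * ((1 + x ^ 2 / r ^ 2) * y ^ 2) +
        (r ^ (j + 1))⁻¹ * (1 + x ^ 2 / r ^ 2)⁻¹ = q * y ^ 2 + q⁻¹ := by
      rw [hq, mul_inv]; ring
    rw [e1]
    have e2 : q * y ^ 2 + q⁻¹ - y = q⁻¹ * ((q * y - 1 / 2) ^ 2 + 3 / 4) := by
      field_simp; ring
    have : 0 ≤ q⁻¹ * ((q * y - 1 / 2) ^ 2 + 3 / 4) := by positivity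
    linarith
  refine hfin.trans ?_
  rw [intervalIntegral.integral_add
    (Continuous.intervalIntegrable (by fun_prop) _ _)
    (Continuous.intervalIntegrable (by fun_prop) _ _),
    intervalIntegral.integral_const_mul, intervalIntegral.integral_const_mul]
  calc _ ≤ r ^ (j + 1) * ((C ^ 2 + Real.pi ^ 2 * D ^ 2 / 4) / r ^ (2 * j + 1)) +
        (r ^ (j + 1))⁻¹ * (Real.pi * r) := by
        have := integral_inv_weight_le (L := L) hr
        gcongr
    _ = Q / r ^ j := by
        simp only [Q]
        rw [hpow, pow_succ r j]
        field_simp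
    _ ≤ _ := by gcongr; linarith

/-- Applying the Fourier multiplier is convolving with the kernel. -/
lemma synth_symb_mul (hL : 1 ≤ L) (j : ℕ) {r : ℝ} (hr : 0 < r) (hr1 : r ≤ 1) {c : ℤ → ℂ}
    (hc : Summable fun k => ‖c k‖) (x : ℝ) :
    synth L (fun k => symb L j r k * c k) x =
      ∫ y in (-L)..L, kern L j r (x - y) * synth L c y := by
  have hL0 : 0 < L := by linarith
  obtain ⟨A, hA, hk⟩ := exists_kern_bounds j
  have hs := summable_symb hL j hr hr1
  have hcont := continuous_kern hL j hr hr1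
  rw [integral_mul_synth (L := L) hc (g := fun y => kern L j r (x - y)) (by fun_prop)
    (fun y => (hk L r hL hr hr1).1 (x - y))]
  refine tsum_congr fun k => ?_
  have h1 : ∫ y in (-L)..L, kern L j r (x - y) * wave L k y =
      wave L k x * ∫ y in (x - L)..(x - -L), kern L j r y * wave L (-k) y := by
    rw [← intervalIntegral.integral_comp_sub_left
      (fun y => kern L j r y * wave L (-k) y), ← intervalIntegral.integral_const_mul]
    refine intervalIntegral.integral_congr fun y _ => ?_
    simp only [wave_sub, neg_neg]
    have : wave L k x * wave L (-k) x = 1 := by rw [← wave_add, add_neg_cancel, wave_zero]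
    linear_combination (-kern L j r (x - y) * wave L k y) * this
  have hper : Function.Periodic (fun y => kern L j r y * wave L (-k) y) (2 * L) := by
    intro y
    simp only [kern, synth_periodic hL0 _ y, wave_periodic hL0 _ y]
  have h2 := hper.intervalIntegral_add_eq (x - L) (-L)
  rw [show x - L + 2 * L = x - -L by ring, show -L + 2 * L = L by ring] at h2
  have h3 := coef_synth hL0 hs k
  rw [h1, h2]
  have h4 : ∫ y in (-L)..L, kern L j r y * wave L (-k) y = symb L j r k := by
    rw [← h3, coef, ← intervalIntegral.integral_const_mul]
    refine intervalIntegral.integral_congr fun y _ => ?_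
    simp only [kern, mul_assoc]
  rw [h4]
  ring

lemma integral_norm_kern_sub (hL : 0 < L) (j : ℕ) {r : ℝ} (x : ℝ) :
    ∫ y in (-L)..L, ‖kern L j r (x - y)‖ = ∫ y in (-L)..L, ‖kern L j r y‖ := by
  have hper : Function.Periodic (fun y => ‖kern L j r y‖) (2 * L) := by
    intro y
    simp only [kern, synth_periodic hL _ y]
  have h2 := hper.intervalIntegral_add_eq (x - L) (-L)
  rw [show x - L + 2 * L = x - -L by ring, show -L + 2 * L = L by ring] at h2
  rw [← h2, ← intervalIntegral.integral_comp_sub_left (fun y => ‖kern L j r y‖)]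

/-- Young's inequality `L¹ * L^∞ → L^∞` for the kernel, so each derivative put on the linear
evolution costs one factor `1/r`. -/
lemma exists_norm_synth_symb_mul_le (j : ℕ) : ∃ A : ℝ, 0 < A ∧ ∀ L r : ℝ, 1 ≤ L → 0 < r → r ≤ 1 →
    ∀ (c : ℤ → ℂ) (X : ℝ), (Summable fun k => ‖c k‖) → (∀ x, ‖synth L c x‖ ≤ X) → ∀ x,
    ‖synth L (fun k => symb L j r k * c k) x‖ ≤ A / r ^ j * X := by
  obtain ⟨A, hA, hk⟩ := exists_kern_bounds j
  refine ⟨A, hA, fun L r hL hr hr1 c X hc hX x => ?_⟩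
  have hcont := (continuous_kern hL j hr hr1).comp (continuous_const (y := x) |>.sub continuous_id)
  have hX0 : 0 ≤ X := (norm_nonneg _).trans (hX 0)
  rw [synth_symb_mul hL j hr hr1 hc]
  have h1 := intervalIntegral.norm_integral_le_of_norm_le (μ := volume) (a := -L) (b := L)
    (f := fun y => kern L j r (x - y) * synth L c y) (g := fun y => ‖kern L j r (x - y)‖ * X)
    (by linarith) (Eventually.of_forall fun y _ => by
      rw [norm_mul]; exact mul_le_mul_of_nonneg_left (hX y) (norm_nonneg _))
    ((hcont.norm.mul continuous_const).intervalIntegrable _ _)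
  refine h1.trans ?_
  rw [intervalIntegral.integral_mul_const, integral_norm_kern_sub (by linarith)]
  exact mul_le_mul_of_nonneg_right (hk L r hL hr hr1).2 hX0

/-! ### Decay of coefficients and derivatives of a square -/

/-- Fourier coefficients of the `m`-th derivative. -/
noncomputable def dmul (L : ℝ) (m : ℕ) (c : ℤ → ℂ) (k : ℤ) : ℂ := (Complex.I * freq L k) ^ m * c k

/-- Polynomial decay of order `2 n` of a sequence of Fourier coefficients. -/
def Decays (L : ℝ) (n : ℕ) (B : ℝ) (c : ℤ → ℂ) : Prop :=
  ∀ k, ‖c k‖ ≤ B / (1 + freq L k ^ 2) ^ n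

lemma dmul_zero (c : ℤ → ℂ) : dmul L 0 c = c := by funext k; simp [dmul]

lemma norm_I_mul_freq (k : ℤ) : ‖Complex.I * (freq L k : ℂ)‖ = |freq L k| := by simp

lemma abs_pow_le_one_add_sq (x : ℝ) (m : ℕ) : |x| ^ m ≤ (1 + x ^ 2) ^ m := by
  refine pow_le_pow_left₀ (abs_nonneg x) ?_ m
  nlinarith [sq_abs x, sq_nonneg (|x| - 1)]

lemma summable_inv_weight (hL : 1 ≤ L) : Summable fun k : ℤ => 1 / (1 + freq L k ^ 2) := by
  simpa using (lattice_sum hL one_pos le_rfl).1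

lemma Decays.summable (hL : 1 ≤ L) {c : ℤ → ℂ} {B : ℝ} (h : Decays L 1 B c) :
    Summable fun k => ‖c k‖ := by
  refine Summable.of_nonneg_of_le (fun _ => norm_nonneg _) h ?_
  simpa [div_eq_mul_inv] using (summable_inv_weight hL).mul_left B

lemma Decays.dmul {c : ℤ → ℂ} {B : ℝ} {n m : ℕ} (h : Decays L (n + m) B c) :
    Decays L n B (dmul L m c) := by
  intro k
  have h0 : 0 < 1 + freq L k ^ 2 := by positivity
  have h1 := h k
  rw [pow_add, le_div_iff₀ (by positivity)] at h1
  rw [le_div_iff₀ (by positivity), KuramotoSivashinsky.dmul, norm_mul, norm_pow, norm_I_mul_freq]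
  have := abs_pow_le_one_add_sq (freq L k) m
  calc _ ≤ (1 + freq L k ^ 2) ^ m * ‖c k‖ * (1 + freq L k ^ 2) ^ n := by gcongr
    _ = ‖c k‖ * ((1 + freq L k ^ 2) ^ n * (1 + freq L k ^ 2) ^ m) := by ring
    _ ≤ B := h1

/-- Sequences decaying faster than any polynomial. -/
def Rapid (L : ℝ) (c : ℤ → ℂ) : Prop := ∀ n, ∃ B, Decays L n B c

lemma Rapid.dmul {c : ℤ → ℂ} (h : Rapid L c) (m : ℕ) : Rapid L (dmul L m c) := fun n =>
  (h (n + m)).imp fun _ hB => hB.dmul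

lemma Rapid.summable (hL : 1 ≤ L) {c : ℤ → ℂ} (h : Rapid L c) : Summable fun k => ‖c k‖ :=
  (h 1).elim fun _ hB => hB.summable hL

/-- Since `ξ_k = ξ_j + ξ_{k-j}`, the larger of the two weights controls the weight at `k`, and one
power of the smaller one is left to sum over `j`. This is why the order is at least `1`. The
constant depends on `L`, which is allowed because it is used only qualitatively. -/
lemma Decays.conv (hL : 1 ≤ L) {c d : ℤ → ℂ} {B D : ℝ} {n : ℕ} (hB : 0 ≤ B) (hD : 0 ≤ D)
    (hc : Decays L (n + 1) B c) (hd : Decays L (n + 1) D d) :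
    Decays L (n + 1) (B * D * 4 ^ (n + 1) * (4 * L)) (conv c d) := by
  intro k
  obtain ⟨hs, ht⟩ := lattice_sum (L := L) hL one_pos le_rfl
  simp only [one_mul, div_one] at hs ht
  have hsk : Summable fun j : ℤ => 1 / (1 + freq L (k - j) ^ 2) :=
    ((Equiv.subLeft k).summable_iff (f := fun j : ℤ => 1 / (1 + freq L j ^ 2))).2 hs
  have htk : ∑' j : ℤ, 1 / (1 + freq L (k - j) ^ 2) = ∑' j : ℤ, 1 / (1 + freq L j ^ 2) :=
    (Equiv.subLeft k).tsum_eq fun j : ℤ => 1 / (1 + freq L j ^ 2)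
  set W := (1 + freq L k ^ 2) ^ (n + 1) with hW
  have hterm : ∀ j, ‖c j * d (k - j)‖ ≤ B * D * 4 ^ (n + 1) / W *
      (1 / (1 + freq L j ^ 2) + 1 / (1 + freq L (k - j) ^ 2)) := by
    intro j
    set X := 1 + freq L j ^ 2 with hX
    set Y := 1 + freq L (k - j) ^ 2 with hY
    have hX1 : 1 ≤ X := by nlinarith [sq_nonneg (freq L j)]
    have hY1 : 1 ≤ Y := by nlinarith [sq_nonneg (freq L (k - j))]
    have hk : freq L k = freq L j + freq L (k - j) := by rw [freq_sub]; ring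
    have h1 : ‖c j * d (k - j)‖ ≤ B * D / (X ^ (n + 1) * Y ^ (n + 1)) := by
      rw [norm_mul]
      calc _ ≤ B / X ^ (n + 1) * (D / Y ^ (n + 1)) :=
            mul_le_mul (hc j) (hd _) (norm_nonneg _) (by positivity)
        _ = _ := by field_simp
    refine h1.trans ?_
    have hsum : 1 + freq L k ^ 2 ≤ 2 * (X + Y) := by
      rw [hk]; nlinarith [sq_nonneg (freq L j - freq L (k - j))]
    have hkey : ∀ P Q : ℝ, 1 ≤ P → 1 ≤ Q → Q ≤ P → 1 + freq L k ^ 2 ≤ 2 * (P + Q) →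
        1 / (P ^ (n + 1) * Q ^ (n + 1)) ≤ 4 ^ (n + 1) / W * (1 / Q) := by
      intro P Q hP hQ hQP hs
      have h2 : W ≤ 4 ^ (n + 1) * P ^ (n + 1) := by
        rw [hW, ← mul_pow]
        exact pow_le_pow_left₀ (by positivity) (by linarith) _
      have h3 : Q ≤ Q ^ (n + 1) := le_self_pow₀ hQ (by omega)
      rw [div_mul_div_comm, mul_one, div_le_div_iff₀ (by positivity) (by positivity)]
      calc 1 * (W * Q) ≤ (4 ^ (n + 1) * P ^ (n + 1)) * Q ^ (n + 1) := by rw [one_mul]; gcongr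
        _ = _ := by ring
    have hfin : 1 / (X ^ (n + 1) * Y ^ (n + 1)) ≤ 4 ^ (n + 1) / W * (1 / X + 1 / Y) := by
      have p1 : 0 ≤ 4 ^ (n + 1) / W * (1 / X) := by positivity
      have p2 : 0 ≤ 4 ^ (n + 1) / W * (1 / Y) := by positivity
      rcases le_total X Y with h | h
      · have := hkey Y X hY1 hX1 h (by linarith)
        rw [mul_comm (X ^ (n + 1)), mul_add]; linarith
      · have := hkey X Y hX1 hY1 h (by linarith)
        rw [mul_add]; linarith
    calc B * D / (X ^ (n + 1) * Y ^ (n + 1)) = B * D * (1 / (X ^ (n + 1) * Y ^ (n + 1))) := by ring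
      _ ≤ B * D * (4 ^ (n + 1) / W * (1 / X + 1 / Y)) := by gcongr
      _ = _ := by ring
  have hS : Summable fun j => B * D * 4 ^ (n + 1) / W *
      (1 / (1 + freq L j ^ 2) + 1 / (1 + freq L (k - j) ^ 2)) := (hs.add hsk).mul_left _
  have hn : Summable fun j => ‖c j * d (k - j)‖ :=
    Summable.of_nonneg_of_le (fun _ => norm_nonneg _) hterm hS
  calc ‖KuramotoSivashinsky.conv c d k‖ ≤ ∑' j, ‖c j * d (k - j)‖ := norm_tsum_le_tsum_norm hn
    _ ≤ ∑' j, B * D * 4 ^ (n + 1) / W *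
      (1 / (1 + freq L j ^ 2) + 1 / (1 + freq L (k - j) ^ 2)) := hn.tsum_le_tsum hterm hS
    _ = B * D * 4 ^ (n + 1) / W * (2 * ∑' j, 1 / (1 + freq L j ^ 2)) := by
        rw [tsum_mul_left, hs.tsum_add hsk, htk, two_mul]
    _ ≤ B * D * 4 ^ (n + 1) / W * (2 * (2 * L)) := by gcongr
    _ = _ := by ring

/-- The Leibniz rule for Fourier coefficients. -/
lemma dmul_conv (hL : 1 ≤ L) {c d : ℤ → ℂ} (hc : Rapid L c) (hd : Rapid L d) (m : ℕ) (k : ℤ) :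
    dmul L m (conv c d) k = ∑ i ∈ Finset.range (m + 1),
      (m.choose i : ℂ) * conv (dmul L i c) (dmul L (m - i) d) k := by
  have hs : ∀ i, Summable fun j => dmul L i c j * dmul L (m - i) d (k - j) := fun i =>
    summable_conv_term ((hc.dmul i).summable hL) ((hd.dmul (m - i)).summable hL) k
  have hl : dmul L m (conv c d) k = ∑' j, (Complex.I * freq L k) ^ m * (c j * d (k - j)) := by
    rw [dmul, conv, tsum_mul_left]
  rw [hl]
  simp only [conv, ← tsum_mul_left]
  rw [← Summable.tsum_finsetSum fun i _ => (hs i).mul_left _]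
  refine tsum_congr fun j => ?_
  have h : Complex.I * (freq L k : ℂ) =
      Complex.I * freq L j + Complex.I * freq L (k - j) := by
    rw [freq_sub]; push_cast; ring
  rw [h, add_pow, Finset.sum_mul]
  refine Finset.sum_congr rfl fun i _ => ?_
  simp only [dmul]
  ring

lemma synth_sum {ι : Type*} (s : Finset ι) (a : ι → ℂ) {c : ι → ℤ → ℂ}
    (hc : ∀ i ∈ s, Summable fun k => ‖c i k‖) (x : ℝ) :
    synth L (fun k => ∑ i ∈ s, a i * c i k) x = ∑ i ∈ s, a i * synth L (c i) x := by
  simp only [synth, Finset.sum_mul, ← tsum_mul_left]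
  rw [Summable.tsum_finsetSum fun i hi => ?_]
  · simp only [mul_assoc]
  · simpa only [mul_assoc] using (summable_synth (L := L) (hc i hi) x).mul_left (a i)

lemma sum_choose_real (m : ℕ) : ∑ i ∈ Finset.range (m + 1), (m.choose i : ℝ) = 2 ^ m := by
  exact_mod_cast Nat.sum_range_choose m

/-- Sup bound for the derivatives of a square. -/
lemma norm_synth_dmul_conv_le (hL : 1 ≤ L) {c : ℤ → ℂ} (hc : Rapid L c) {m : ℕ} {C R : ℝ}
    (h : ∀ i ≤ m, ∀ x, ‖synth L (dmul L i c) x‖ ≤ C * R ^ (3 + i)) (x : ℝ) :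
    ‖synth L (dmul L m (conv c c)) x‖ ≤ 2 ^ m * C ^ 2 * R ^ (6 + m) := by
  have hs : ∀ i, Summable fun k => ‖dmul L i c k‖ := fun i => (hc.dmul i).summable hL
  have h1 : dmul L m (conv c c) = fun k => ∑ i ∈ Finset.range (m + 1),
      (m.choose i : ℂ) * conv (dmul L i c) (dmul L (m - i) c) k :=
    funext fun k => dmul_conv hL hc hc m k
  rw [h1, synth_sum _ _ (fun i _ => summable_conv (hs i) (hs (m - i)))]
  refine (norm_sum_le _ _).trans ?_
  rw [← sum_choose_real, Finset.sum_mul, Finset.sum_mul]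
  refine Finset.sum_le_sum fun i hi => ?_
  have hi' : i ≤ m := by simpa [Nat.lt_succ_iff] using hi
  rw [synth_conv (hs i) (hs (m - i)), norm_mul, norm_mul, Complex.norm_natCast, mul_assoc]
  refine mul_le_mul_of_nonneg_left ?_ (by positivity)
  have e1 := h i hi' x
  have e2 := h (m - i) (Nat.sub_le _ _) x
  calc _ ≤ (C * R ^ (3 + i)) * (C * R ^ (3 + (m - i))) :=
        mul_le_mul e1 e2 (norm_nonneg _) ((norm_nonneg _).trans e1)
    _ = C ^ 2 * R ^ ((3 + i) + (3 + (m - i))) := by rw [pow_add R (3 + i)]; ring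
    _ = _ := by congr 2; omega

/-- `L²` bound for the derivatives of a square. -/
lemma sum_sq_dmul_conv_le (hL : 1 ≤ L) {c : ℤ → ℂ} (hc : Rapid L c) {m : ℕ} {C R h : ℝ}
    (h1 : ∀ i ≤ m, ∀ x, ‖synth L (dmul L i c) x‖ ≤ C * R ^ (3 + i))
    (h2 : ∀ i ≤ m, ∀ S : Finset ℤ, ∑ k ∈ S, ‖dmul L i c k‖ ^ 2 ≤ (C * R ^ i * h) ^ 2)
    (S : Finset ℤ) :
    ∑ k ∈ S, ‖dmul L m (conv c c) k‖ ^ 2 ≤ ((m + 1) * 2 ^ m * C ^ 2 * R ^ (3 + m) * h) ^ 2 := by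
  have hs : ∀ i, Summable fun k => ‖dmul L i c k‖ := fun i => (hc.dmul i).summable hL
  -- Cauchy–Schwarz over the `m + 1` Leibniz terms, with every binomial coefficient bounded by `2 ^
  -- m`. Each term is then estimated with `i` derivatives in `L^∞` and `m - i` in `L²`.
  have e1 : ∀ k, ‖dmul L m (conv c c) k‖ ^ 2 ≤ (m + 1) * ∑ i ∈ Finset.range (m + 1),
      (2 ^ m) ^ 2 * ‖conv (dmul L i c) (dmul L (m - i) c) k‖ ^ 2 := by
    intro k
    rw [dmul_conv hL hc hc]
    have e2 := norm_sum_le (Finset.range (m + 1)) fun i =>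
      (m.choose i : ℂ) * conv (dmul L i c) (dmul L (m - i) c) k
    have e3 := sq_sum_le_card_mul_sum_sq (s := Finset.range (m + 1)) (f := fun i =>
      ‖(m.choose i : ℂ) * conv (dmul L i c) (dmul L (m - i) c) k‖)
    calc _ ≤ _ := pow_le_pow_left₀ (norm_nonneg _) e2 2
      _ ≤ _ := e3
      _ ≤ _ := by
        rw [Finset.card_range]
        push_cast
        gcongr with i hi
        rw [norm_mul, mul_pow, Complex.norm_natCast]
        gcongr
        exact_mod_cast Nat.choose_le_two_pow m i
  refine (Finset.sum_le_sum fun k _ => e1 k).trans ?_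
  rw [← Finset.mul_sum, Finset.sum_comm]
  have e4 : ∀ i ∈ Finset.range (m + 1), ∑ k ∈ S, (2 ^ m : ℝ) ^ 2 *
      ‖conv (dmul L i c) (dmul L (m - i) c) k‖ ^ 2 ≤
      (2 ^ m) ^ 2 * (C ^ 2 * R ^ (3 + m) * h) ^ 2 := by
    intro i hi
    have hi' : i ≤ m := by simpa [Nat.lt_succ_iff] using hi
    rw [← Finset.mul_sum]
    refine mul_le_mul_of_nonneg_left ?_ (by positivity)
    refine (sum_sq_conv_le (by linarith) (hs i) (hs (m - i)) (h1 i hi')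
      (h2 (m - i) (Nat.sub_le _ _)) S).trans (le_of_eq ?_)
    rw [← mul_pow]
    congr 1
    have : R ^ (3 + m) = R ^ (3 + i) * R ^ (m - i) := by rw [← pow_add]; congr 1; omega
    rw [this]; ring
  refine (mul_le_mul_of_nonneg_left (Finset.sum_le_sum e4) (by positivity)).trans (le_of_eq ?_)
  rw [Finset.sum_const, Finset.card_range, nsmul_eq_mul]
  push_cast
  ring

/-! ### Spectral solutions and Duhamel's formula; times are fourth powers of lengths -/

/-- The fourth root. -/
noncomputable def qrt (s : ℝ) : ℝ := √√s

lemma qrt_pow_four {s : ℝ} (hs : 0 ≤ s) : qrt s ^ 4 = s := by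
  rw [qrt, show 4 = 2 * 2 by norm_num, pow_mul, Real.sq_sqrt (Real.sqrt_nonneg _), Real.sq_sqrt hs]

lemma qrt_nonneg (s : ℝ) : 0 ≤ qrt s := Real.sqrt_nonneg _

lemma qrt_pos {s : ℝ} (hs : 0 < s) : 0 < qrt s := Real.sqrt_pos.2 (Real.sqrt_pos.2 hs)

lemma qrt_le_one {s : ℝ} (hs1 : s ≤ 1) : qrt s ≤ 1 :=
  Real.sqrt_le_one.2 (Real.sqrt_le_one.2 hs1)

lemma qrt_of_pow_four {r : ℝ} (hr : 0 ≤ r) : qrt (r ^ 4) = r := by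
  rw [qrt, show 4 = 2 * 2 by norm_num, pow_mul, Real.sqrt_sq (by positivity), Real.sqrt_sq hr]

lemma qrt_mono {s t : ℝ} (h : s ≤ t) : qrt s ≤ qrt t := Real.sqrt_le_sqrt (Real.sqrt_le_sqrt h)

lemma qrt_rpow {s : ℝ} (hs : 0 ≤ s) (a : ℝ) : qrt s ^ a = s ^ (a / 4) := by
  rw [qrt, Real.sqrt_eq_rpow, Real.sqrt_eq_rpow, ← Real.rpow_mul hs, ← Real.rpow_mul hs]
  congr 1; ring

/-- A solution of the equation in terms of its Fourier coefficients `c`, smooth in space for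
positive times, together with the Fourier coefficients `b` of its square. -/
structure SpectralSolution (L : ℝ) (c b : ℝ → ℤ → ℂ) : Prop where
  decay : ∀ (n : ℕ) (ε : ℝ), 0 < ε → ∃ B, 0 ≤ B ∧ ∀ t, ε ≤ t → Decays L n B (c t)
  conv_eq : ∀ t, 0 < t → b t = conv (c t) (c t)
  cont : ∀ k, ContinuousOn (fun t => b t k) (Ioi 0)
  duhamel : ∀ t₁ t, 0 < t₁ → t₁ ≤ t → ∀ k, c t k =
    (Real.exp (-((t - t₁) * rate L k)) : ℝ) * c t₁ k - ∫ τ in t₁..t,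
      Complex.I * freq L k / 2 * (Real.exp (-((t - τ) * rate L k)) : ℝ) * b τ k

namespace SpectralSolution

variable {c b : ℝ → ℤ → ℂ}

lemma rapid (h : SpectralSolution L c b) {t : ℝ} (ht : 0 < t) : Rapid L (c t) := fun n => by
  obtain ⟨B, -, hB⟩ := h.decay n t ht
  exact ⟨B, hB t le_rfl⟩

lemma decay_sq (h : SpectralSolution L c b) (hL : 1 ≤ L) (n : ℕ) {ε : ℝ} (hε : 0 < ε) :
    ∃ B, 0 ≤ B ∧ ∀ t, ε ≤ t → Decays L (n + 1) B (b t) := by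
  obtain ⟨B, hB0, hB⟩ := h.decay (n + 1) ε hε
  refine ⟨B * B * 4 ^ (n + 1) * (4 * L), by positivity, fun t ht => ?_⟩
  rw [h.conv_eq t (hε.trans_le ht)]
  exact (hB t ht).conv hL hB0 hB0 (hB t ht)

lemma rapid_sq (h : SpectralSolution L c b) (hL : 1 ≤ L) {t : ℝ} (ht : 0 < t) :
    Rapid L (b t) := fun n => by
  obtain ⟨B, hB0, hB⟩ := h.decay_sq hL n ht
  refine ⟨B, fun k => (hB t le_rfl k).trans ?_⟩
  have : 1 ≤ 1 + freq L k ^ 2 := by nlinarith [sq_nonneg (freq L k)]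
  exact div_le_div_of_nonneg_left hB0 (by positivity) (pow_le_pow_right₀ this (by omega))

/-- Duhamel's formula for the coefficients of a derivative, the derivatives being shared between
the linear evolution and the data. -/
lemma duhamel_dmul (h : SpectralSolution L c b) {t₁ t : ℝ} (h1 : 0 < t₁) (h2 : t₁ ≤ t)
    (m j : ℕ) (k : ℤ) : dmul L (m + j) (c t) k =
      symb L j (qrt (t - t₁)) k * dmul L m (c t₁) k -
        ∫ τ in t₁..t, (2 : ℂ)⁻¹ * (symb L (j + 1) (qrt (t - τ)) k * dmul L m (b τ) k) := by
  rw [dmul, h.duhamel t₁ t h1 h2 k, mul_sub, ← intervalIntegral.integral_const_mul]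
  congr 1
  · rw [symb, qrt_pow_four (by linarith), dmul]; ring
  · refine intervalIntegral.integral_congr fun τ hτ => ?_
    rw [uIcc_of_le h2] at hτ
    simp only [symb, dmul]
    rw [qrt_pow_four (by linarith [hτ.2])]
    ring

/-- Unstable modes grow at rate at most `1`, hence by at most a factor `e` over unit time. Unlike
the smoothing bounds this one does not blow up as `r → 0`, so it can dominate the Duhamel integrand
up to the final time; it costs powers of the frequency, which rapid decay pays for. -/
lemma norm_symb_le (j : ℕ) {r : ℝ} (hr : 0 ≤ r) (hr1 : r ≤ 1) (k : ℤ) :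
    ‖symb L j r k‖ ≤ Real.exp 1 * |freq L k| ^ j := by
  rw [symb, norm_mul, norm_pow, norm_I_mul_freq, Complex.norm_real, Real.norm_eq_abs,
    Real.abs_exp, mul_comm]
  refine mul_le_mul_of_nonneg_right (Real.exp_le_exp.2 ?_) (by positivity)
  have h4 : r ^ 4 ≤ 1 := pow_le_one₀ hr hr1
  have h5 : 0 ≤ r ^ 4 := by positivity
  have : -rate L k ≤ 1 := by
    rw [rate]; nlinarith [sq_nonneg (freq L k ^ 2 - 1), sq_nonneg (freq L k)]
  nlinarith

lemma continuousOn_duhamel (h : SpectralSolution L c b) {t₁ t : ℝ} (h1 : 0 < t₁)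
    (m j : ℕ) (k : ℤ) : ContinuousOn
      (fun τ => symb L (j + 1) (qrt (t - τ)) k * dmul L m (b τ) k) (Icc t₁ t) := by
  have e1 : Continuous fun τ => symb L (j + 1) (qrt (t - τ)) k := by
    unfold symb qrt; fun_prop
  have e2 : ContinuousOn (fun τ => dmul L m (b τ) k) (Icc t₁ t) := by
    unfold dmul
    exact continuousOn_const.mul ((h.cont k).mono fun τ hτ => h1.trans_le hτ.1)
  exact e1.continuousOn.mul e2

lemma duhamel_synth (h : SpectralSolution L c b) (hL : 1 ≤ L) {t₁ t : ℝ} (h1 : 0 < t₁)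
    (h2 : t₁ < t) (h3 : t ≤ t₁ + 1) (m j : ℕ) (x : ℝ) :
    synth L (dmul L (m + j) (c t)) x =
      synth L (fun k => symb L j (qrt (t - t₁)) k * dmul L m (c t₁) k) x -
        ∫ τ in t₁..t, (2 : ℂ)⁻¹ *
          synth L (fun k => symb L (j + 1) (qrt (t - τ)) k * dmul L m (b τ) k) x := by
  -- Of the available weights, `n + i` are spent on derivatives and one is kept for summability over
  -- the modes.
  have bound : ∀ (i n : ℕ) (d : ℤ → ℂ) (B : ℝ), Decays L (1 + (n + i)) B d → ∀ r : ℝ, 0 ≤ r →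
      r ≤ 1 → Decays L 1 (Real.exp 1 * B) fun k => symb L i r k * dmul L n d k := by
    intro i n d B hd r hr hr1 k
    have e1 := hd.dmul k
    rw [dmul, norm_mul, norm_pow, norm_I_mul_freq, pow_add] at e1
    change ‖symb L i r k * ((Complex.I * freq L k) ^ n * d k)‖ ≤ _
    rw [norm_mul, norm_mul, norm_pow, norm_I_mul_freq]
    have e2 := norm_symb_le (L := L) i hr hr1 k
    calc _ ≤ (Real.exp 1 * |freq L k| ^ i) * (|freq L k| ^ n * ‖d k‖) := by gcongr
      _ = Real.exp 1 * (|freq L k| ^ n * |freq L k| ^ i * ‖d k‖) := by ring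
      _ ≤ Real.exp 1 * (B / (1 + freq L k ^ 2) ^ 1) := by gcongr
      _ = _ := by ring
  obtain ⟨B, hB0, hB⟩ := h.decay (1 + (m + j)) t₁ h1
  obtain ⟨D, hD0, hD⟩ := h.decay_sq hL (m + (j + 1)) h1
  have hlin := (bound j m _ B (hB t₁ le_rfl) (qrt (t - t₁)) (qrt_nonneg _)
    (qrt_le_one (by linarith))).summable hL
  have hnl : ∀ τ ∈ Icc t₁ t, Decays L 1 (Real.exp 1 * D)
      fun k => symb L (j + 1) (qrt (t - τ)) k * dmul L m (b τ) k := fun τ hτ =>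
    bound (j + 1) m _ D (by rw [add_comm]; exact hD τ hτ.1) _ (qrt_nonneg _)
      (qrt_le_one (by linarith [hτ.1]))
  have hw := (summable_inv_weight hL)
  have hsum := intervalIntegral.hasSum_integral_of_dominated_convergence (μ := volume) (a := t₁)
    (b := t) (F := fun (k : ℤ) τ =>
      (2 : ℂ)⁻¹ * (symb L (j + 1) (qrt (t - τ)) k * dmul L m (b τ) k) * wave L k x)
    (f := fun τ => (2 : ℂ)⁻¹ *
          synth L (fun k => symb L (j + 1) (qrt (t - τ)) k * dmul L m (b τ) k) x)
    (fun k _ => 2⁻¹ * (Real.exp 1 * D) * (1 / (1 + freq L k ^ 2)))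
    (fun k => by
      rw [uIoc_of_le h2.le]
      have e1 := ((h.continuousOn_duhamel (t := t) h1 m j k).mono
        Ioc_subset_Icc_self)
      exact ((continuousOn_const.mul e1).mul continuousOn_const).aestronglyMeasurable
        measurableSet_Ioc)
    (fun k => Eventually.of_forall fun τ hτ => by
      rw [uIoc_of_le h2.le] at hτ
      have e1 := hnl τ (Ioc_subset_Icc_self hτ) k
      rw [pow_one] at e1
      rw [norm_mul, norm_mul, norm_wave, mul_one, mul_assoc]
      have e2 : ‖(2 : ℂ)⁻¹‖ = 2⁻¹ := by simp
      rw [e2]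
      refine mul_le_mul_of_nonneg_left (e1.trans (le_of_eq (by ring))) (by norm_num))
    (Eventually.of_forall fun τ _ => hw.mul_left _) (by simp)
    (Eventually.of_forall fun τ hτ => by
      rw [uIoc_of_le h2.le] at hτ
      have e1 := (summable_synth (L := L) ((hnl τ (Ioc_subset_Icc_self hτ)).summable hL)
        x).hasSum.mul_left (2 : ℂ)⁻¹
      simpa only [synth, mul_assoc] using e1)
  rw [← hsum.tsum_eq, synth, synth,
    ← (summable_synth (L := L) hlin x).tsum_sub hsum.summable]
  refine tsum_congr fun k => ?_
  rw [h.duhamel_dmul h1 h2.le m j k, sub_mul, intervalIntegral.integral_mul_const]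

/-- Sup bound from Duhamel's formula. -/
lemma norm_synth_le_of_duhamel (h : SpectralSolution L c b) (hL : 1 ≤ L) {t₁ t : ℝ} (h1 : 0 < t₁)
    (h2 : t₁ < t) (h3 : t ≤ t₁ + 1) {m j : ℕ} {x P Q a : ℝ} (ha : a ≤ 1 / 2) (hQ : 0 ≤ Q)
    (hP : ‖synth L (fun k => symb L j (qrt (t - t₁)) k * dmul L m (c t₁) k) x‖ ≤ P)
    (hQb : ∀ τ, t₁ ≤ τ → τ < t →
      ‖synth L (fun k => symb L (j + 1) (qrt (t - τ)) k * dmul L m (b τ) k) x‖ ≤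
        Q * (t - τ) ^ (-a)) :
    ‖synth L (dmul L (m + j) (c t)) x‖ ≤ P + Q * (t - t₁) ^ (1 - a) := by
  rw [h.duhamel_synth hL h1 h2 h3]
  refine (norm_sub_le _ _).trans (add_le_add hP ?_)
  have hi : IntervalIntegrable (fun τ => 2⁻¹ * (Q * (t - τ) ^ (-a))) volume t₁ t := by
    have := (intervalIntegral.intervalIntegrable_rpow' (a := t - t₁) (b := t - t) (r := -a)
      (by linarith)).comp_sub_left t
    simp only [sub_sub_cancel] at this
    exact (this.const_mul Q).const_mul _
  have h0 : ∀ᵐ τ : ℝ ∂volume, τ ∈ Ioc t₁ t → ‖(2 : ℂ)⁻¹ *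
      synth L (fun k => symb L (j + 1) (qrt (t - τ)) k * dmul L m (b τ) k) x‖ ≤
        2⁻¹ * (Q * (t - τ) ^ (-a)) := by
    -- The pointwise bound is assumed only for `τ < t`, where the singular power is meaningful; the
    -- endpoint is a null set.
    have : ∀ᵐ τ : ℝ ∂volume, τ ≠ t := by simp [ae_iff, measure_singleton]
    filter_upwards [this] with τ hne hτ
    rw [norm_mul, norm_inv, Complex.norm_ofNat]
    exact mul_le_mul_of_nonneg_left (hQb τ hτ.1.le (lt_of_le_of_ne hτ.2 hne)) (by norm_num)
  refine (intervalIntegral.norm_integral_le_of_norm_le h2.le h0 hi).trans ?_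
  rw [intervalIntegral.integral_const_mul, intervalIntegral.integral_const_mul,
    intervalIntegral.integral_comp_sub_left (fun s => s ^ (-a)), sub_self,
    integral_rpow (Or.inl (by linarith)), Real.zero_rpow (by linarith), sub_zero,
    show -a + 1 = 1 - a by ring]
  have hp : 0 ≤ (t - t₁) ^ (1 - a) := Real.rpow_nonneg (by linarith) _
  -- As `a ≤ 1/2`, the factor `1/(1 - a)` is at most `2`, which cancels the `1/2` of the
  -- nonlinearity `(u²/2)_x`.
  have : (t - t₁) ^ (1 - a) / (1 - a) ≤ 2 * (t - t₁) ^ (1 - a) := by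
    rw [div_le_iff₀ (by linarith)]; nlinarith
  nlinarith [mul_le_mul_of_nonneg_left this hQ]

end SpectralSolution

/-! ### Smoothing from `L^p` to `L^∞` -/

lemma toReal_one_div_le_one {p : ℝ≥0∞} (hp : 1 ≤ p) : (1 / p).toReal ≤ 1 := by
  have h1 : (1 / p) ≤ 1 := by simpa using hp
  exact (ENNReal.toReal_mono ENNReal.one_ne_top h1).trans_eq ENNReal.toReal_one

/-- Splitting at the level `l`: above it, `y = y^(1-q) y^q` and the first power is decreasing in
`y`. This elementary truncation takes the place of Hölder's inequality below. -/
lemma le_add_rpow_mul_rpow {y l q : ℝ} (hy : 0 ≤ y) (hl : 0 < l) (hq : 1 ≤ q) :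
    y ≤ l + l ^ (1 - q) * y ^ q := by
  rcases le_total y l with h | h
  · have : 0 ≤ l ^ (1 - q) * y ^ q := by positivity
    linarith
  · have hy0 : 0 < y := hl.trans_le h
    have h1 : y ^ (1 - q) ≤ l ^ (1 - q) :=
      Real.rpow_le_rpow_of_nonpos hl h (by linarith)
    have h2 : y = y ^ (1 - q) * y ^ q := by
      rw [← Real.rpow_add hy0]; simp
    have h3 : y ^ (1 - q) * y ^ q ≤ l ^ (1 - q) * y ^ q := by gcongr
    linarith

/-- Smoothing from `L^p` to `L^∞` by a kernel concentrated at length scale `r`. -/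
lemma integral_mul_le_of_eLpNorm_le (hL : 0 < L) {p : ℝ≥0∞} (hp : 1 ≤ p) {A r K G : ℝ}
    (hA : 0 ≤ A) (hr : 0 < r) (hK : 0 < K) (hG : 0 ≤ G) {g : ℝ → ℝ} {f : ℝ → ℂ}
    (hg : Continuous g) (hf : Continuous f) (hg0 : ∀ x, 0 ≤ g x) (hg1 : ∀ x, g x ≤ A * G / r)
    (hg2 : ∫ x in (-L)..L, g x ≤ A * G)
    (hfp : eLpNorm f p (periodMeasure L) ≤ ENNReal.ofReal K) :
    ∫ x in (-L)..L, g x * ‖f x‖ ≤ 2 * A * G * (K * r ^ (-(1 / p).toReal)) := by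
  have hLL : -L ≤ L := by linarith
  by_cases hpt : p = ⊤
  · subst hpt
    have h1 : ∀ᵐ x ∂(volume.restrict (Ioc (-L) L)), ‖f x‖ ≤ K := by
      rw [eLpNorm_exponent_top] at hfp
      filter_upwards [enorm_ae_le_eLpNormEssSup f (periodMeasure L)] with x hx
      have := hx.trans hfp
      rwa [← ofReal_norm, ENNReal.ofReal_le_ofReal_iff hK.le] at this
    have h2 : ∫ x in (-L)..L, g x * ‖f x‖ ≤ ∫ x in (-L)..L, g x * K := by
      refine intervalIntegral.integral_mono_ae_restrict hLL
        ((hg.mul hf.norm).intervalIntegrable _ _)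
        ((hg.mul continuous_const).intervalIntegrable _ _) ?_
      rw [← restrict_Ioc_eq_restrict_Icc]
      filter_upwards [h1] with x hx
      exact mul_le_mul_of_nonneg_left hx (hg0 x)
    refine h2.trans ?_
    rw [intervalIntegral.integral_mul_const]
    simp only [one_div, ENNReal.inv_top, ENNReal.toReal_zero, neg_zero, Real.rpow_zero, mul_one]
    have : 0 ≤ A * G * K := by positivity
    nlinarith [mul_le_mul_of_nonneg_right hg2 hK.le]
  · set q := p.toReal with hq
    have hq1 : 1 ≤ q := by
      have := ENNReal.toReal_mono hpt hp
      simpa using this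
    have hq0 : 0 < q := by linarith
    have he : (1 / p).toReal = 1 / q := by rw [ENNReal.toReal_div, ENNReal.toReal_one]
    rw [he]
    have hfq : ∫ x in (-L)..L, ‖f x‖ ^ q ≤ K ^ q := by
      have h1 := (memLp_of_continuous (L := L) hf p).eLpNorm_eq_integral_rpow_norm
        (by positivity : p ≠ 0) hpt
      rw [h1, ENNReal.ofReal_le_ofReal_iff hK.le, ← hq] at hfp
      have h2 : 0 ≤ ∫ x, ‖f x‖ ^ q ∂(periodMeasure L) := integral_nonneg fun x => by positivity
      have h3 := Real.rpow_le_rpow (by positivity) hfp hq0.le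
      rw [← Real.rpow_mul h2, inv_mul_cancel₀ hq0.ne', Real.rpow_one] at h3
      rwa [intervalIntegral.integral_of_le hLL]
    -- This level balances the two parts: the low part pairs with the mass `A * G` of `g`, the high
    -- part with its sup `A * G / r`, and each contributes at most `A * G * l`.
    set l := K * r ^ (-(1 / q)) with hl
    have hl0 : 0 < l := by positivity
    have hc : Continuous fun x => ‖f x‖ ^ q :=
      hf.norm.rpow_const fun x => Or.inr hq0.le
    have h2 : ∫ x in (-L)..L, g x * ‖f x‖ ≤
        ∫ x in (-L)..L, (g x * l + A * G / r * l ^ (1 - q) * ‖f x‖ ^ q) := by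
      refine intervalIntegral.integral_mono_on hLL
        ((hg.mul hf.norm).intervalIntegrable _ _)
        (Continuous.intervalIntegrable (by fun_prop) _ _) fun x _ => ?_
      have e1 := le_add_rpow_mul_rpow (norm_nonneg (f x)) hl0 hq1
      have e2 := hg1 x
      have e3 := hg0 x
      have e4 : 0 ≤ l ^ (1 - q) * ‖f x‖ ^ q := by positivity
      calc g x * ‖f x‖ ≤ g x * (l + l ^ (1 - q) * ‖f x‖ ^ q) := by gcongr
        _ = g x * l + g x * (l ^ (1 - q) * ‖f x‖ ^ q) := by ring
        _ ≤ g x * l + A * G / r * (l ^ (1 - q) * ‖f x‖ ^ q) := by gcongr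
        _ = _ := by ring
    refine h2.trans ?_
    rw [intervalIntegral.integral_add (Continuous.intervalIntegrable (by fun_prop) _ _)
      (Continuous.intervalIntegrable (by fun_prop) _ _), intervalIntegral.integral_mul_const,
      intervalIntegral.integral_const_mul]
    have h3 : A * G / r * l ^ (1 - q) * ∫ x in (-L)..L, ‖f x‖ ^ q ≤
        A * G / r * l ^ (1 - q) * K ^ q := by gcongr
    have h4 : l ^ (1 - q) * K ^ q = l * r := by
      have e1 : l ^ q = K ^ q * r⁻¹ := by
        rw [hl, Real.mul_rpow hK.le (by positivity), ← Real.rpow_mul hr.le,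
          show -(1 / q) * q = -1 by field_simp, Real.rpow_neg_one]
      rw [Real.rpow_sub hl0, Real.rpow_one, e1]
      have : 0 < K ^ q := by positivity
      field_simp
    have h5 : A * G / r * l ^ (1 - q) * K ^ q = A * G * l := by
      rw [mul_assoc, h4]; field_simp
    nlinarith [mul_le_mul_of_nonneg_right hg2 hl0.le]

namespace SpectralSolution

variable {c b : ℝ → ℤ → ℂ}

/-- `L^∞` bound for positive times in terms of `L^p` bounds, `R` being an inverse length. -/
theorem exists_norm_synth_le {p : ℝ≥0∞} (hp : 1 ≤ p) {δ : ℝ} (hδ : 0 < δ) : ∃ C : ℝ, 0 < C ∧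
    ∀ (L : ℝ) (c b : ℝ → ℤ → ℂ), 1 ≤ L → SpectralSolution L c b → ∀ R : ℝ, 1 ≤ R →
      (∀ t, 0 < t → eLpNorm (synth L (c t)) p (periodMeasure L) ≤
        ENNReal.ofReal (R ^ (3 - (1 / p).toReal))) →
      ∀ t, δ ≤ t → ∀ x, ‖synth L (c t) x‖ ≤ C * R ^ 3 := by
  obtain ⟨A₀, hA₀, hk0⟩ := exists_kern_bounds 0
  obtain ⟨A₁, hA₁, hk1⟩ := exists_kern_bounds 1
  set e := (1 / p).toReal with he
  have he0 : 0 ≤ e := ENNReal.toReal_nonneg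
  have he1 : e ≤ 1 := toReal_one_div_le_one hp
  set A := max A₀ A₁ with hA
  have hA0 : 0 < A := lt_max_of_lt_left hA₀
  -- The bound `δ/2` keeps the starting time `t₁` positive, and `1/(8A)` makes the map in `step` a
  -- contraction with factor `1/2`.
  set θ := min (min 1 (δ / 2)) (1 / (8 * A)) with hθ
  have hθ0 : 0 < θ := by positivity
  have hθ1 : θ ≤ 1 := (min_le_left _ _).trans (min_le_left _ _)
  have hθδ : θ ≤ δ / 2 := (min_le_left _ _).trans (min_le_right _ _)
  have hθA : θ ≤ 1 / (8 * A) := min_le_right _ _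
  refine ⟨1 / θ ^ 3, by positivity, fun L c b hL h R hR hLp t₀ ht₀ => ?_⟩
  have hL0 : 0 < L := by linarith
  set K := R ^ (3 - e) with hK
  have hK0 : 0 < K := by positivity
  have hs : ∀ t, 0 < t → Summable fun k => ‖c t k‖ := fun t ht => (h.rapid ht).summable hL
  have hsb : ∀ t, 0 < t → Summable fun k => ‖b t k‖ := fun t ht => (h.rapid_sq hL ht).summable hL
  set r₀ := θ / R with hr₀
  have hr₀0 : 0 < r₀ := by positivity
  have hr₀θ : r₀ ≤ θ := div_le_self hθ0.le hR
  have hr₀1 : r₀ ≤ 1 := hr₀θ.trans hθ1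
  set t₁ := t₀ - r₀ ^ 4 with ht₁
  have hr4 : r₀ ^ 4 ≤ θ := (pow_le_of_le_one hr₀0.le hr₀1 (by norm_num)).trans hr₀θ
  have hr4' : 0 < r₀ ^ 4 := by positivity
  have ht₁0 : 0 < t₁ := by linarith
  have hsm : ∀ (j : ℕ) (Aj : ℝ), Aj ≤ A → (∀ L r : ℝ, 1 ≤ L → 0 < r → r ≤ 1 →
      (∀ x, ‖kern L j r x‖ ≤ Aj / r ^ (j + 1)) ∧ ∫ x in (-L)..L, ‖kern L j r x‖ ≤ Aj / r ^ j) →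
      ∀ (r : ℝ), 0 < r → r ≤ 1 → ∀ t, 0 < t → ∀ x, ∫ y in (-L)..L,
        ‖kern L j r (x - y)‖ * ‖synth L (c t) y‖ ≤ 2 * A * (1 / r ^ j) * (K * r ^ (-e)) := by
    intro j Aj hAj hk r hr hr1 t ht x
    obtain ⟨k1, k2⟩ := hk L r hL hr hr1
    have hkc := continuous_kern hL j hr hr1
    refine integral_mul_le_of_eLpNorm_le hL0 hp hA0.le hr hK0 (by positivity)
      (g := fun y => ‖kern L j r (x - y)‖) (by fun_prop) (continuous_synth (hs t ht))
      (fun y => norm_nonneg _) (fun y => (k1 _).trans ?_) ?_ (hLp t ht)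
    · rw [mul_one_div, div_div, ← pow_succ]; gcongr
    · rw [integral_norm_kern_sub hL0, mul_one_div]; exact k2.trans (by gcongr)
  -- A bound `B` for `(t - t₁)^(3/4) |u|` on the whole interval improves to `(1 + B)/2`. In the
  -- quadratic term one factor is estimated by `B` in sup norm and the other by its `L^p` norm, so
  -- the improvement is affine in `B`.
  have step : ∀ B : ℝ, 0 ≤ B →
      (∀ t, t₁ < t → t ≤ t₀ → ∀ x, qrt (t - t₁) ^ 3 * ‖synth L (c t) x‖ ≤ B) →
      ∀ t, t₁ < t → t ≤ t₀ → ∀ x, qrt (t - t₁) ^ 3 * ‖synth L (c t) x‖ ≤ (1 + B) / 2 := by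
    intro B hB0 hB t ht ht' x
    -- Duhamel is restarted at the midpoint of `[t₁, t]`. On the second half the time weight is at
    -- least `ρ ^ 3`, so `|u| ≤ B/ρ³` there with no singularity at `t₁`.
    set σ := (t - t₁) / 2 with hσ
    have hσ0 : 0 < σ := by rw [hσ]; linarith
    set ρ := qrt σ with hρ
    have hρ0 : 0 < ρ := qrt_pos hσ0
    have hσ4 : ρ ^ 4 = σ := qrt_pow_four hσ0.le
    have hρr : ρ ≤ r₀ := by
      rw [← qrt_of_pow_four hr₀0.le]; exact qrt_mono (by rw [hσ]; linarith)
    have hρ1 : ρ ≤ 1 := hρr.trans hr₀1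
    have hts : 0 < t - σ := by rw [hσ]; linarith
    have hmain := h.norm_synth_le_of_duhamel hL hts (t := t) (by linarith)
      (by nlinarith [pow_le_one₀ (n := 4) hρ0.le hρ1]) (m := 0) (j := 0) (x := x)
      (P := 2 * A * (K * ρ ^ (-e))) (Q := 2 * A * K * (B / ρ ^ 3)) (a := (1 + e) / 4)
      (by linarith) (by positivity)
      (by
        rw [sub_sub_cancel, dmul_zero, synth_symb_mul hL 0 hρ0 hρ1 (hs _ hts)]
        refine (intervalIntegral.norm_integral_le_integral_norm (by linarith)).trans ?_
        simp only [norm_mul]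
        simpa using hsm 0 A₀ (le_max_left _ _) hk0 ρ hρ0 hρ1 _ hts x)
      (by
        intro τ h1 h2
        have hτ : 0 < t - τ := by linarith
        set r := qrt (t - τ) with hr
        have hr0 : 0 < r := qrt_pos hτ
        have hr1 : r ≤ 1 := qrt_le_one (by nlinarith [pow_le_one₀ (n := 4) hρ0.le hρ1])
        have hτ0 : 0 < τ := by linarith
        have hsup : ∀ y, ‖synth L (c τ) y‖ ≤ B / ρ ^ 3 := by
          intro y
          rw [le_div_iff₀ (by positivity), mul_comm]
          refine le_trans ?_ (hB τ (by linarith) (by linarith) y)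
          have : ρ ≤ qrt (τ - t₁) := qrt_mono (by linarith)
          gcongr
        have hkc := continuous_kern hL 1 hr0 hr1
        have hcc := continuous_synth (L := L) (hs τ hτ0)
        rw [dmul_zero, synth_symb_mul hL 1 hr0 hr1 (hsb _ hτ0), h.conv_eq τ hτ0]
        have e1 := intervalIntegral.norm_integral_le_of_norm_le (μ := volume) (a := -L) (b := L)
          (f := fun y => kern L 1 r (x - y) * synth L (conv (c τ) (c τ)) y)
          (g := fun y => B / ρ ^ 3 * (‖kern L 1 r (x - y)‖ * ‖synth L (c τ) y‖))
          (by linarith) (Eventually.of_forall fun y _ => by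
            rw [synth_conv (hs τ hτ0) (hs τ hτ0), norm_mul, norm_mul]
            have := hsup y
            calc ‖kern L 1 r (x - y)‖ * (‖synth L (c τ) y‖ * ‖synth L (c τ) y‖)
                = ‖synth L (c τ) y‖ * (‖kern L 1 r (x - y)‖ * ‖synth L (c τ) y‖) := by ring
              _ ≤ _ := by gcongr)
          (Continuous.intervalIntegrable (by fun_prop) _ _)
        refine e1.trans ?_
        rw [intervalIntegral.integral_const_mul]
        have e2 := hsm 1 A₁ (le_max_right _ _) hk1 r hr0 hr1 τ hτ0 x
        -- The derivative costs `r⁻¹` and passing from `L^p` to `L^∞` costs `r^(-e)`. Together they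
        -- give a time singularity of exponent `(1 + e)/4 ≤ 1/2`.
        have e3 : (t - τ) ^ (-((1 + e) / 4)) = 1 / r ^ 1 * r ^ (-e) := by
          rw [show -((1 + e) / 4) = (-(1 + e)) / 4 by ring, ← qrt_rpow hτ.le, ← hr,
            show -(1 + e) = -1 + -e by ring, Real.rpow_add hr0, Real.rpow_neg_one, pow_one,
            one_div]
        rw [e3]
        calc B / ρ ^ 3 * _ ≤ B / ρ ^ 3 * (2 * A * (1 / r ^ 1) * (K * r ^ (-e))) := by gcongr
          _ = _ := by ring)
    rw [dmul_zero, sub_sub_cancel] at hmain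
    have e4 : σ ^ (1 - (1 + e) / 4) = ρ ^ (3 - e) := by
      rw [hρ, qrt_rpow hσ0.le]; congr 1; ring
    have e5 : ρ ^ 3 * ρ ^ (-e) = ρ ^ (3 - e) := by
      rw [← Real.rpow_natCast ρ 3, ← Real.rpow_add hρ0]; congr 1
    -- Scale invariance: with `K = R^(3-e)` and `ρ ≤ r₀ = θ/R` all powers of `R` cancel, leaving
    -- `θ^(3-e) ≤ θ`.
    have e6 : K * ρ ^ (3 - e) ≤ θ := by
      calc K * ρ ^ (3 - e) ≤ K * r₀ ^ (3 - e) := by gcongr; linarith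
        _ = θ ^ (3 - e) := by
          rw [hK, ← Real.mul_rpow (by linarith) hr₀0.le, hr₀, mul_div_cancel₀ _ (by positivity)]
        _ ≤ θ ^ (1 : ℝ) := Real.rpow_le_rpow_of_exponent_ge hθ0 hθ1 (by linarith)
        _ = θ := Real.rpow_one _
    have e7 : qrt (t - t₁) ^ 3 ≤ 2 * ρ ^ 3 := by
      have hq4 : qrt (t - t₁) ^ 4 = 2 * ρ ^ 4 := by
        rw [hσ4, qrt_pow_four (by linarith), hσ]; ring
      have hmono : ρ ≤ qrt (t - t₁) := qrt_mono (by rw [hσ]; linarith)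
      have : qrt (t - t₁) ^ 3 * ρ ≤ 2 * ρ ^ 3 * ρ := by
        calc _ ≤ qrt (t - t₁) ^ 3 * qrt (t - t₁) := by
              have := qrt_nonneg (t - t₁); gcongr
          _ = qrt (t - t₁) ^ 4 := by ring
          _ = _ := by rw [hq4]; ring
      exact le_of_mul_le_mul_right this hρ0
    have hθA' : A * θ ≤ 1 / 8 := by
      calc A * θ ≤ A * (1 / (8 * A)) := by gcongr
        _ = _ := by field_simp
    calc qrt (t - t₁) ^ 3 * ‖synth L (c t) x‖ ≤ 2 * ρ ^ 3 *
          (2 * A * (K * ρ ^ (-e)) + 2 * A * K * (B / ρ ^ 3) * ρ ^ (3 - e)) := by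
          rw [e4] at hmain
          gcongr
      _ = 4 * A * (K * (ρ ^ 3 * ρ ^ (-e))) + 4 * A * B * (K * ρ ^ (3 - e)) := by
          field_simp; ring
      _ ≤ 4 * A * θ + 4 * A * B * θ := by
          rw [e5]; gcongr
      _ = 4 * (A * θ) * (1 + B) := by ring
      _ ≤ 4 * (1 / 8) * (1 + B) := by gcongr
      _ = _ := by ring
  obtain ⟨D, hD0, hD⟩ := h.decay 1 t₁ ht₁0
  -- The contraction needs some finite starting bound. This one depends on `L` and the solution, but
  -- its contribution is halved at each iteration and vanishes in the limit, leaving the fixed point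
  -- `1`.
  have hinit : ∃ B₀ : ℝ, 0 ≤ B₀ ∧
      ∀ t, t₁ < t → t ≤ t₀ → ∀ x, qrt (t - t₁) ^ 3 * ‖synth L (c t) x‖ ≤ B₀ := by
    refine ⟨∑' k : ℤ, D * (1 / (1 + freq L k ^ 2)),
      tsum_nonneg fun k => by positivity, fun t ht ht' x => ?_⟩
    have hc := hs t (ht₁0.trans ht)
    have h1 : ‖synth L (c t) x‖ ≤ ∑' k : ℤ, D * (1 / (1 + freq L k ^ 2)) := by
      refine (norm_synth_le hc x).trans (hc.tsum_le_tsum (fun k => ?_)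
        ((summable_inv_weight hL).mul_left D))
      have := hD t ht.le k
      rwa [pow_one, div_eq_mul_one_div] at this
    have h2 : qrt (t - t₁) ^ 3 ≤ 1 := pow_le_one₀ (qrt_nonneg _) (qrt_le_one (by linarith))
    exact (mul_le_of_le_one_left (norm_nonneg _) h2).trans h1
  obtain ⟨B₀, hB₀, hB⟩ := hinit
  have hiter : ∀ n : ℕ, ∀ t, t₁ < t → t ≤ t₀ → ∀ x,
      qrt (t - t₁) ^ 3 * ‖synth L (c t) x‖ ≤ 1 + B₀ / 2 ^ n := by
    intro n
    induction n with
    | zero => intro t h1 h2 x; have := hB t h1 h2 x; simp; linarith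
    | succ n ih =>
      intro t h1 h2 x
      refine (step _ (by positivity) ih t h1 h2 x).trans (le_of_eq ?_)
      rw [pow_succ]; field_simp; ring
  intro x
  have hlim : Tendsto (fun n : ℕ => 1 + B₀ / 2 ^ n) atTop (𝓝 (1 + 0)) :=
    tendsto_const_nhds.add (tendsto_const_nhds.div_atTop
      (tendsto_pow_atTop_atTop_of_one_lt one_lt_two))
  have hfin := ge_of_tendsto' hlim fun n => hiter n t₀ (by linarith) le_rfl x
  rw [ht₁, sub_sub_cancel, qrt_of_pow_four hr₀0.le, add_zero, hr₀, div_pow] at hfin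
  have hR0 : 0 < R := by linarith
  rw [div_mul_eq_mul_div, div_le_one (by positivity)] at hfin
  rw [div_mul_eq_mul_div, one_mul, le_div_iff₀ (by positivity), mul_comm]
  exact hfin

end SpectralSolution

/-! ### Sup and `L²` bounds for all derivatives -/

lemma sq_integral_mul_le {F G : ℝ → ℝ} {a b : ℝ} (hab : a ≤ b) (hF : ContinuousOn F (Icc a b))
    (hG : ContinuousOn G (Icc a b)) :
    (∫ x in a..b, F x * G x) ^ 2 ≤ (∫ x in a..b, F x ^ 2) * ∫ x in a..b, G x ^ 2 := by
  rw [← uIcc_of_le hab] at hF hG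
  have i1 : IntervalIntegrable (fun x => F x ^ 2) volume a b := (hF.pow 2).intervalIntegrable
  have i2 : IntervalIntegrable (fun x => F x * G x) volume a b := (hF.mul hG).intervalIntegrable
  have i3 : IntervalIntegrable (fun x => G x ^ 2) volume a b := (hG.pow 2).intervalIntegrable
  have h := discrim_le_zero (a := ∫ x in a..b, F x ^ 2) (b := 2 * ∫ x in a..b, F x * G x)
    (c := ∫ x in a..b, G x ^ 2) fun y => by
      have h1 : 0 ≤ ∫ x in a..b, (y * F x + G x) ^ 2 :=
        intervalIntegral.integral_nonneg hab fun x _ => sq_nonneg _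
      have h2 : ∫ x in a..b, (y * F x + G x) ^ 2 =
          ∫ x in a..b, (y ^ 2 * F x ^ 2 + 2 * y * (F x * G x) + G x ^ 2) :=
        intervalIntegral.integral_congr fun x _ => by ring
      rw [h2, intervalIntegral.integral_add ((i1.const_mul _).add (i2.const_mul _)) i3,
        intervalIntegral.integral_add (i1.const_mul _) (i2.const_mul _),
        intervalIntegral.integral_const_mul, intervalIntegral.integral_const_mul] at h1
      linarith
  rw [discrim] at h
  linarith

lemma sq_norm_integral_mul_le {f g : ℝ → ℂ} {a b : ℝ} (hab : a ≤ b)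
    (hf : ContinuousOn f (Icc a b)) (hg : ContinuousOn g (Icc a b)) :
    ‖∫ x in a..b, f x * g x‖ ^ 2 ≤ (∫ x in a..b, ‖f x‖ ^ 2) * ∫ x in a..b, ‖g x‖ ^ 2 := by
  refine le_trans ?_ (sq_integral_mul_le hab hf.norm hg.norm)
  refine pow_le_pow_left₀ (norm_nonneg _) ?_ 2
  refine (intervalIntegral.norm_integral_le_integral_norm hab).trans (le_of_eq ?_)
  simp only [norm_mul]

/-- Maximal regularity: two derivatives of the linear evolution are square integrable in time. -/
lemma integral_sq_symb_two_le {t₁ t : ℝ} (h1 : t₁ ≤ t) (h2 : t ≤ t₁ + 1) (k : ℤ) :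
    ∫ τ in t₁..t, ‖symb L 2 (qrt (t - τ)) k‖ ^ 2 ≤ Real.exp 1 := by
  set x := freq L k ^ 4 with hx
  have hx0 : 0 ≤ x := by positivity
  have hd : ∀ τ ∈ uIcc t₁ t, HasDerivAt (fun τ => Real.exp 1 * Real.exp (-((t - τ) * x)))
      (Real.exp 1 * (x * Real.exp (-((t - τ) * x)))) τ := fun τ _ => by
    have := (((((hasDerivAt_id τ).const_sub t).mul_const x).neg).exp).const_mul (Real.exp 1)
    refine this.congr_deriv ?_
    simp only [id, Pi.neg_apply]; ring
  have hc : Continuous fun τ => Real.exp 1 * (x * Real.exp (-((t - τ) * x))) := by fun_prop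
  have hi := intervalIntegral.integral_eq_sub_of_hasDerivAt hd (hc.intervalIntegrable _ _)
  have hm : ∫ τ in t₁..t, ‖symb L 2 (qrt (t - τ)) k‖ ^ 2 ≤
      ∫ τ in t₁..t, Real.exp 1 * (x * Real.exp (-((t - τ) * x))) := by
    refine intervalIntegral.integral_mono_on h1
      (Continuous.intervalIntegrable (by unfold symb qrt; fun_prop) _ _)
      (hc.intervalIntegrable _ _) fun τ hτ => ?_
    have hs0 : 0 ≤ t - τ := by linarith [hτ.2]
    have hs1 : t - τ ≤ 1 := by linarith [hτ.1]
    rw [symb, qrt_pow_four hs0, norm_mul, norm_pow, norm_I_mul_freq, Complex.norm_real,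
      Real.norm_eq_abs, Real.abs_exp, mul_pow, ← Real.exp_nat_mul]
    have e1 : (|freq L k| ^ 2) ^ 2 = x := by rw [sq_abs, ← pow_mul]
    rw [e1, mul_left_comm, ← Real.exp_add]
    refine mul_le_mul_of_nonneg_left (Real.exp_le_exp.2 ?_) hx0
    have e2 : rate L k = x - freq L k ^ 2 := rfl
    -- Over unit time the destabilising second-order term costs only a factor `e`; what remains has
    -- an explicit primitive, with integral at most `1`.
    have e3 : 2 * freq L k ^ 2 - x ≤ 1 := by
      rw [hx]; nlinarith [sq_nonneg (freq L k ^ 2 - 1)]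
    rw [e2]
    push_cast
    nlinarith
  refine hm.trans ?_
  rw [hi, sub_self, zero_mul, neg_zero, Real.exp_zero, mul_one]
  have : 0 ≤ Real.exp 1 * Real.exp (-((t - t₁) * x)) := by positivity
  linarith

namespace SpectralSolution

/-- Uniform bounds for all derivatives, in units of the length `1 / R`. -/
theorem exists_norm_synth_dmul_le {C₀ : ℝ} (hC₀ : 0 < C₀) (m : ℕ) : ∀ δ : ℝ, 0 < δ →
    ∃ C : ℝ, 0 < C ∧ ∀ (L : ℝ) (c b : ℝ → ℤ → ℂ), 1 ≤ L → SpectralSolution L c b →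
      ∀ R t₀ : ℝ, 1 ≤ R → 0 < t₀ → (∀ t, t₀ ≤ t → ∀ x, ‖synth L (c t) x‖ ≤ C₀ * R ^ 3) →
      ∀ i ≤ m, ∀ t, t₀ + δ ≤ t → ∀ x, ‖synth L (dmul L i (c t)) x‖ ≤ C * R ^ (3 + i) := by
  induction m with
  | zero =>
    intro δ hδ
    refine ⟨C₀, hC₀, fun L c b _ _ R t₀ _ _ h i hi t ht x => ?_⟩
    obtain rfl : i = 0 := by omega
    rw [dmul_zero]
    exact h t (by linarith) x
  | succ m ih =>
    intro δ hδ
    -- Half of the waiting time goes to the lower derivatives, the other half to one smoothing step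
    -- of duration `r ^ 4 ≤ θ ≤ δ/2`.
    obtain ⟨C, hC, hCm⟩ := ih (δ / 2) (by linarith)
    obtain ⟨A₁, hA₁, hk1⟩ := exists_norm_synth_symb_mul_le 1
    obtain ⟨A₂, hA₂, hk2⟩ := exists_norm_synth_symb_mul_le 2
    set θ := min 1 (δ / 2) with hθ
    have hθ0 : 0 < θ := by positivity
    have hθ1 : θ ≤ 1 := min_le_left _ _
    have hθδ : θ ≤ δ / 2 := min_le_right _ _
    refine ⟨max C (A₁ * C / θ + A₂ * (2 ^ m * C ^ 2)), lt_max_of_lt_left hC,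
      fun L c b hL h R t₀ hR ht₀ h0 i hi t ht x => ?_⟩
    have hb := hCm L c b hL h R t₀ hR ht₀ h0
    have hR0 : 0 < R := by linarith
    rcases Nat.lt_or_ge i (m + 1) with hi' | hi'
    · refine (hb i (by omega) t (by linarith) x).trans ?_
      gcongr
      exact le_max_left _ _
    obtain rfl : i = m + 1 := by omega
    -- On the time scale `r ^ 4` the linear term costs `1/r ~ R`. In the nonlinear term `m`
    -- derivatives stay on the square, of size `R^(6+m)`, and two go to the kernel; the integrable
    -- singularity `(t - τ)^(-1/2)` returns `r² ≤ R⁻²`. Both terms are thus of order `R^(4+m)`.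
    set r := θ / R with hr
    have hr0 : 0 < r := by positivity
    have hrθ : r ≤ θ := div_le_self hθ0.le hR
    have hr1 : r ≤ 1 := hrθ.trans hθ1
    have hr4 : r ^ 4 ≤ θ := (pow_le_of_le_one hr0.le hr1 (by norm_num)).trans hrθ
    have hr4' : 0 < r ^ 4 := by positivity
    have ht1 : t₀ + δ / 2 ≤ t - r ^ 4 := by linarith
    have hpos : 0 < t - r ^ 4 := by linarith
    have hmain := h.norm_synth_le_of_duhamel hL hpos (t := t) (by linarith)
      (by linarith) (m := m) (j := 1) (x := x) (P := A₁ / r ^ 1 * (C * R ^ (3 + m)))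
      (Q := A₂ * (2 ^ m * C ^ 2 * R ^ (6 + m))) (a := 1 / 2) le_rfl (by positivity)
      (by
        rw [sub_sub_cancel, qrt_of_pow_four hr0.le]
        exact hk1 L r hL hr0 hr1 _ _ (((h.rapid hpos).dmul m).summable hL)
          (hb m le_rfl _ ht1) x)
      (by
        intro τ h1 h2
        have hτ : 0 < τ := by linarith
        have hs : 0 < t - τ := by linarith
        refine (hk2 L (qrt (t - τ)) hL (qrt_pos hs) (qrt_le_one (by linarith)) _ _
          (((h.rapid_sq hL hτ).dmul m).summable hL) (fun y => by
            rw [h.conv_eq τ hτ]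
            exact norm_synth_dmul_conv_le hL (h.rapid hτ)
              (fun i hi => hb i hi τ (by linarith)) y) x).trans (le_of_eq ?_)
        have : (t - τ) ^ (-(1 / 2) : ℝ) = 1 / qrt (t - τ) ^ 2 := by
          rw [← Real.rpow_natCast, qrt_rpow hs.le, Real.rpow_neg hs.le, one_div]
          norm_num
        rw [this]; ring)
    refine hmain.trans ?_
    have e1 : (t - (t - r ^ 4)) ^ (1 - 1 / 2 : ℝ) = r ^ 2 := by
      rw [sub_sub_cancel, show (1 - 1 / 2 : ℝ) = 1 / 2 by norm_num, ← Real.sqrt_eq_rpow,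
        show r ^ 4 = (r ^ 2) ^ 2 by ring,
        Real.sqrt_sq (by positivity)]
    rw [e1]
    have e2 : r ^ 2 ≤ 1 / R ^ 2 := by
      rw [hr, div_pow]; gcongr; exact pow_le_one₀ hθ0.le hθ1
    calc _ ≤ A₁ / r ^ 1 * (C * R ^ (3 + m)) +
          A₂ * (2 ^ m * C ^ 2 * R ^ (6 + m)) * (1 / R ^ 2) := by gcongr
      _ = (A₁ * C / θ + A₂ * (2 ^ m * C ^ 2)) * R ^ (3 + (m + 1)) := by
          rw [hr, show 6 + m = 3 + (m + 1) + 2 by ring, pow_add R _ 2,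
            show 3 + (m + 1) = 3 + m + 1 by ring, pow_succ R (3 + m)]
          field_simp
      _ ≤ _ := by gcongr; exact le_max_right _ _

/-- Uniform `L²` bounds for all derivatives, in units of the length `1 / R`. -/
theorem exists_sum_sq_dmul_le {C₀ : ℝ} (hC₀ : 0 < C₀) (m : ℕ) : ∀ δ : ℝ, 0 < δ →
    ∃ C : ℝ, 0 < C ∧ ∀ (L : ℝ) (c b : ℝ → ℤ → ℂ), 1 ≤ L → SpectralSolution L c b →
      ∀ R t₀ h : ℝ, 1 ≤ R → 0 < t₀ → 0 ≤ h →
      (∀ t, t₀ ≤ t → ∀ x, ‖synth L (c t) x‖ ≤ C₀ * R ^ 3) →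
      (∀ t, t₀ ≤ t → ∀ S : Finset ℤ, ∑ k ∈ S, ‖c t k‖ ^ 2 ≤ h ^ 2) →
      ∀ i ≤ m, ∀ t, t₀ + δ ≤ t → ∀ S : Finset ℤ,
        ∑ k ∈ S, ‖dmul L i (c t) k‖ ^ 2 ≤ (C * R ^ i * h) ^ 2 := by
  induction m with
  | zero =>
    intro δ hδ
    refine ⟨1, one_pos, fun L c b _ _ R t₀ h _ _ _ _ h2 i hi t ht S => ?_⟩
    obtain rfl : i = 0 := by omega
    simpa [dmul_zero] using h2 t (by linarith) S
  | succ m ih =>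
    intro δ hδ
    obtain ⟨C₁, hC₁, hCm⟩ := ih (δ / 2) (by linarith)
    obtain ⟨C₂, hC₂, hSm⟩ := exists_norm_synth_dmul_le hC₀ m (δ / 2) (by linarith)
    obtain ⟨A, hA, hk⟩ := exists_norm_symb_le 1
    set C := max C₁ C₂ with hCdef
    have hC : 0 < C := lt_max_of_lt_left hC₁
    set θ := min 1 (δ / 2) with hθ
    have hθ0 : 0 < θ := by positivity
    have hθ1 : θ ≤ 1 := min_le_left _ _
    have hθδ : θ ≤ δ / 2 := min_le_right _ _
    set D := (m + 1) * 2 ^ m * C ^ 2 with hD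
    have hD0 : 0 < D := by positivity
    refine ⟨max C (2 * (A / θ * C) + 2 * (Real.exp 1 * D)), lt_max_of_lt_left hC,
      fun L c b hL hsol R t₀ h hR ht₀ hh h0 h2 i hi t ht S => ?_⟩
    have hR0 : 0 < R := by linarith
    have hb : ∀ i ≤ m, ∀ t, t₀ + δ / 2 ≤ t → ∀ S : Finset ℤ,
        ∑ k ∈ S, ‖dmul L i (c t) k‖ ^ 2 ≤ (C * R ^ i * h) ^ 2 := fun i hi t ht S => by
      refine (hCm L c b hL hsol R t₀ h hR ht₀ hh h0 h2 i hi t ht S).trans ?_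
      gcongr
      exact le_max_left _ _
    have hs : ∀ i ≤ m, ∀ t, t₀ + δ / 2 ≤ t → ∀ x,
        ‖synth L (dmul L i (c t)) x‖ ≤ C * R ^ (3 + i) := fun i hi t ht x => by
      refine (hSm L c b hL hsol R t₀ hR ht₀ h0 i hi t ht x).trans ?_
      gcongr
      exact le_max_right _ _
    rcases Nat.lt_or_ge i (m + 1) with hi' | hi'
    · refine (hb i (by omega) t (by linarith) S).trans ?_
      gcongr
      exact le_max_left _ _
    obtain rfl : i = m + 1 := by omega
    set r := θ / R with hr
    have hr0 : 0 < r := by positivity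
    have hrθ : r ≤ θ := div_le_self hθ0.le hR
    have hr1 : r ≤ 1 := hrθ.trans hθ1
    have hr4 : r ^ 4 ≤ θ := (pow_le_of_le_one hr0.le hr1 (by norm_num)).trans hrθ
    have hr4' : 0 < r ^ 4 := by positivity
    set t₁ := t - r ^ 4 with ht₁
    have ht1 : t₀ + δ / 2 ≤ t₁ := by linarith
    have hpos : 0 < t₁ := by linarith
    have hlt : t₁ ≤ t := by linarith
    have hsub : t - t₁ = r ^ 4 := by rw [ht₁]; ring
    have hcb : ∀ k, ContinuousOn (fun τ => dmul L m (b τ) k) (Icc t₁ t) := fun k => by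
      unfold dmul
      exact continuousOn_const.mul ((hsol.cont k).mono fun τ hτ => hpos.trans_le hτ.1)
    -- Done mode by mode: Cauchy–Schwarz in time and `integral_sq_symb_two_le` absorb both
    -- derivatives on the kernel with a constant independent of `k`, so the sum over modes passes
    -- inside the time integral.
    have hterm : ∀ k, ‖dmul L (m + 1) (c t) k‖ ^ 2 ≤
        2 * ((A / r) ^ 2 * ‖dmul L m (c t₁) k‖ ^ 2) +
          2 * (Real.exp 1 * ∫ τ in t₁..t, ‖dmul L m (b τ) k‖ ^ 2) := by
      intro k
      rw [hsol.duhamel_dmul hpos hlt m 1 k, hsub, qrt_of_pow_four hr0.le]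
      have e1 : ‖symb L 1 r k * dmul L m (c t₁) k‖ ^ 2 ≤
          (A / r) ^ 2 * ‖dmul L m (c t₁) k‖ ^ 2 := by
        rw [norm_mul, mul_pow]
        have : ‖symb L 1 r k‖ ≤ A / r := by
          refine (hk L r hr0 hr1 k).trans ?_
          rw [pow_one]
          refine mul_le_of_le_one_right (by positivity) ?_
          rw [div_le_one (by positivity)]
          nlinarith [sq_nonneg (r * freq L k)]
        gcongr
      have e2 : ‖∫ τ in t₁..t, (2 : ℂ)⁻¹ * (symb L (1 + 1) (qrt (t - τ)) k *
          dmul L m (b τ) k)‖ ^ 2 ≤ Real.exp 1 * ∫ τ in t₁..t, ‖dmul L m (b τ) k‖ ^ 2 := by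
        rw [intervalIntegral.integral_const_mul, norm_mul, mul_pow, norm_inv, Complex.norm_ofNat]
        have e3 := sq_norm_integral_mul_le hlt (f := fun τ => symb L (1 + 1) (qrt (t - τ)) k)
          (Continuous.continuousOn (by unfold symb qrt; fun_prop)) (hcb k)
        have e4 := integral_sq_symb_two_le (L := L) hlt (by linarith) k
        have e5 : 0 ≤ ∫ τ in t₁..t, ‖dmul L m (b τ) k‖ ^ 2 :=
          intervalIntegral.integral_nonneg hlt fun _ _ => by positivity
        have e6 := e3.trans (mul_le_mul_of_nonneg_right e4 e5)
        refine le_trans (mul_le_of_le_one_left (by positivity) (by norm_num)) e6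
      set X := symb L 1 r k * dmul L m (c t₁) k
      set Y := ∫ τ in t₁..t, (2 : ℂ)⁻¹ * (symb L (1 + 1) (qrt (t - τ)) k * dmul L m (b τ) k)
      have e7 : ‖X - Y‖ ^ 2 ≤ 2 * ‖X‖ ^ 2 + 2 * ‖Y‖ ^ 2 := by
        have := norm_sub_le X Y
        have := pow_le_pow_left₀ (norm_nonneg _) this 2
        nlinarith [sq_nonneg (‖X‖ - ‖Y‖)]
      linarith
    have hint : ∑ k ∈ S, ∫ τ in t₁..t, ‖dmul L m (b τ) k‖ ^ 2 ≤
        r ^ 4 * (D * R ^ (3 + m) * h) ^ 2 := by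
      have hii : ∀ k ∈ S, IntervalIntegrable (fun τ => ‖dmul L m (b τ) k‖ ^ 2) volume t₁ t :=
        fun k _ => ContinuousOn.intervalIntegrable (by
          rw [uIcc_of_le hlt]; exact ((hcb k).norm.pow 2))
      rw [← intervalIntegral.integral_finsetSum hii]
      have e1 : ∫ τ in t₁..t, ∑ k ∈ S, ‖dmul L m (b τ) k‖ ^ 2 ≤
          ∫ _ in t₁..t, (D * R ^ (3 + m) * h) ^ 2 := by
        refine intervalIntegral.integral_mono_on hlt ?_ (by simp) fun τ hτ => ?_
        · refine ContinuousOn.intervalIntegrable ?_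
          rw [uIcc_of_le hlt]
          exact continuousOn_finsetSum _ fun k _ => (hcb k).norm.pow 2
        · have hτ0 : 0 < τ := hpos.trans_le hτ.1
          rw [hsol.conv_eq τ hτ0]
          exact sum_sq_dmul_conv_le hL (hsol.rapid hτ0)
            (fun i hi => hs i hi τ (ht1.trans hτ.1)) (fun i hi => hb i hi τ (ht1.trans hτ.1)) S
      refine e1.trans (le_of_eq ?_)
      rw [intervalIntegral.integral_const, hsub, smul_eq_mul]
    -- The length of the time interval turns `(R^(3+m) h)²` into `(R^(m+1) h)²`.
    have hr4R : r ^ 4 ≤ 1 / R ^ 4 := by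
      rw [hr, div_pow]; gcongr; exact pow_le_one₀ hθ0.le hθ1
    have he1 : 1 ≤ Real.exp 1 := Real.one_le_exp (by norm_num)
    calc ∑ k ∈ S, ‖dmul L (m + 1) (c t) k‖ ^ 2
        ≤ ∑ k ∈ S, (2 * ((A / r) ^ 2 * ‖dmul L m (c t₁) k‖ ^ 2) +
          2 * (Real.exp 1 * ∫ τ in t₁..t, ‖dmul L m (b τ) k‖ ^ 2)) :=
          Finset.sum_le_sum fun k _ => hterm k
      _ = 2 * ((A / r) ^ 2 * ∑ k ∈ S, ‖dmul L m (c t₁) k‖ ^ 2) +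
          2 * (Real.exp 1 * ∑ k ∈ S, ∫ τ in t₁..t, ‖dmul L m (b τ) k‖ ^ 2) := by
          rw [Finset.sum_add_distrib]; simp only [Finset.mul_sum]
      _ ≤ 2 * ((A / r) ^ 2 * (C * R ^ m * h) ^ 2) +
          2 * (Real.exp 1 * (1 / R ^ 4 * (D * R ^ (3 + m) * h) ^ 2)) := by
          have := hb m le_rfl t₁ ht1 S
          have := hint.trans (mul_le_mul_of_nonneg_right hr4R (sq_nonneg (D * R ^ (3 + m) * h)))
          gcongr
      _ = (2 * (A / θ * C) ^ 2 + 2 * (Real.exp 1 * D ^ 2)) * (R ^ (m + 1) * h) ^ 2 := by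
          rw [hr, show 3 + m = m + 1 + 2 by ring, pow_add R (m + 1) 2, pow_succ R m]
          field_simp
      _ ≤ (2 * (A / θ * C) + 2 * (Real.exp 1 * D)) ^ 2 * (R ^ (m + 1) * h) ^ 2 := by
          refine mul_le_mul_of_nonneg_right ?_ (sq_nonneg _)
          have q1 : 0 < A / θ * C := by positivity
          have q2 : Real.exp 1 * D ^ 2 ≤ (Real.exp 1 * D) ^ 2 := by
            rw [mul_pow (Real.exp 1) D]
            exact mul_le_mul_of_nonneg_right (by nlinarith) (sq_nonneg D)
          have q3 : 0 < Real.exp 1 * D := by positivity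
          nlinarith [mul_pos q1 q3]
      _ = ((2 * (A / θ * C) + 2 * (Real.exp 1 * D)) * R ^ (m + 1) * h) ^ 2 := by ring
      _ ≤ _ := pow_le_pow_left₀ (by positivity) (mul_le_mul_of_nonneg_right
          (mul_le_mul_of_nonneg_right (le_max_right _ _) (by positivity)) hh) 2

end SpectralSolution

/-! ### From distributional solutions to spectral solutions -/

/-- Cauchy–Schwarz, with the normalising factor discarded since `1/(2L) ≤ 1`. Taking `g = 1` treats
`u`, `g = u` treats `u²`, and the pair `u(τ) ∓ u(t)` gives continuity in time of the coefficients of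
`u²`. -/
lemma enorm_coef_mul_le (hL : 1 ≤ L) {f g : ℝ → ℂ} (hf : MemLp f 2 (periodMeasure L))
    (hg : MemLp g 2 (periodMeasure L)) (k : ℤ) :
    ‖coef L (fun x => f x * g x) k‖ₑ ≤
      eLpNorm f 2 (periodMeasure L) * eLpNorm g 2 (periodMeasure L) := by
  have h1 : ‖∫ x in (-L)..L, f x * g x * wave L (-k) x‖ₑ ≤
      eLpNorm (f • g) 1 (periodMeasure L) := by
    rw [intervalIntegral.integral_of_le (by linarith), eLpNorm_one_eq_lintegral_enorm]
    refine (enorm_integral_le_lintegral_enorm _).trans (le_of_eq ?_)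
    refine lintegral_congr fun x => ?_
    have : ‖wave L (-k) x‖ₑ = 1 := by
      rw [← ofReal_norm, norm_wave, ENNReal.ofReal_one]
    rw [enorm_mul, this, mul_one]; rfl
  have h2 : ‖(((2 * L)⁻¹ : ℝ) : ℂ)‖ₑ ≤ 1 := by
    rw [← ofReal_norm, Complex.norm_real, Real.norm_of_nonneg (by positivity),
      ENNReal.ofReal_le_one]
    exact inv_le_one_of_one_le₀ (by linarith)
  rw [coef, enorm_mul]
  calc _ ≤ 1 * (eLpNorm f 2 (periodMeasure L) * eLpNorm g 2 (periodMeasure L)) :=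
        mul_le_mul' h2 (h1.trans (eLpNorm_smul_le_mul_eLpNorm hg.1 hf.1))
    _ = _ := one_mul _

lemma wave_neg_eq_cos_sub_sin (k : ℤ) (x : ℝ) : wave L (-k) x =
    (Real.cos (freq L k * x) : ℂ) - (Real.sin (freq L k * x) : ℂ) * Complex.I := by
  rw [wave, freq_neg, Complex.exp_mul_I]
  push_cast
  rw [neg_mul, Complex.cos_neg, Complex.sin_neg]
  ring

/-- The weak formulation is tested with real functions only, so the complex coefficient has to be
recovered from its cosine and sine parts. -/
lemma coef_ofReal (hL : 0 < L) {f : ℝ → ℝ} (hf : Integrable f (periodMeasure L)) (k : ℤ) :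
    IntervalIntegrable (fun x => f x * Real.cos (freq L k * x)) volume (-L) L ∧
    IntervalIntegrable (fun x => f x * Real.sin (freq L k * x)) volume (-L) L ∧
    ∫ x in (-L)..L, f x * Real.cos (freq L k * x) = 2 * L * (coef L (fun x => (f x : ℂ)) k).re ∧
    ∫ x in (-L)..L, f x * Real.sin (freq L k * x) =
      -(2 * L * (coef L (fun x => (f x : ℂ)) k).im) := by
  have hLL : -L ≤ L := by linarith
  have i1 : IntervalIntegrable (fun x => f x * Real.cos (freq L k * x)) volume (-L) L := by
    rw [intervalIntegrable_iff_integrableOn_Ioc_of_le hLL]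
    exact hf.mul_bdd (c := 1) (Continuous.aestronglyMeasurable (by fun_prop))
      (Eventually.of_forall fun x => Real.abs_cos_le_one _)
  have i2 : IntervalIntegrable (fun x => f x * Real.sin (freq L k * x)) volume (-L) L := by
    rw [intervalIntegrable_iff_integrableOn_Ioc_of_le hLL]
    exact hf.mul_bdd (c := 1) (Continuous.aestronglyMeasurable (by fun_prop))
      (Eventually.of_forall fun x => Real.abs_sin_le_one _)
  have h : coef L (fun x => (f x : ℂ)) k = ((2 * L)⁻¹ : ℝ) *
      (((∫ x in (-L)..L, f x * Real.cos (freq L k * x) : ℝ) : ℂ) -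
        ((∫ x in (-L)..L, f x * Real.sin (freq L k * x) : ℝ) : ℂ) * Complex.I) := by
    rw [coef]
    congr 1
    rw [← intervalIntegral.integral_ofReal, ← intervalIntegral.integral_ofReal,
      ← intervalIntegral.integral_mul_const, ← intervalIntegral.integral_sub
      (show IntervalIntegrable (fun x => ((f x * Real.cos (freq L k * x) : ℝ) : ℂ))
        volume (-L) L from
        ⟨i1.1.ofReal, i1.2.ofReal⟩)
      (IntervalIntegrable.mul_const (show IntervalIntegrable
        (fun x => ((f x * Real.sin (freq L k * x) : ℝ) : ℂ)) volume (-L) L from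
        ⟨i2.1.ofReal, i2.2.ofReal⟩) _)]
    refine intervalIntegral.integral_congr fun x _ => ?_
    simp only [wave_neg_eq_cos_sub_sin]
    push_cast
    ring
  refine ⟨i1, i2, ?_, ?_⟩ <;> rw [h] <;>
    simp only [Complex.mul_re, Complex.mul_im, Complex.sub_re, Complex.sub_im, Complex.ofReal_re,
      Complex.ofReal_im, Complex.I_re, Complex.I_im] <;> field_simp <;> ring

/-- Fourier coefficients of the solution. -/
noncomputable def solCoef (L : ℝ) (u : ℝ → ℝ → ℝ) (t : ℝ) : ℤ → ℂ :=
  coef L fun x => (u t x : ℂ)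

/-- Fourier coefficients of the square of the solution. -/
noncomputable def sqCoef (L : ℝ) (u : ℝ → ℝ → ℝ) (t : ℝ) : ℤ → ℂ :=
  coef L fun x => ((u t x ^ 2 : ℝ) : ℂ)

lemma eLpNorm_ofReal_comp (f : ℝ → ℝ) (p : ℝ≥0∞) :
    eLpNorm (fun x => (f x : ℂ)) p (periodMeasure L) = periodNorm L p f :=
  eLpNorm_congr_norm_ae (Eventually.of_forall fun x => by simp)

lemma deriv_const_mul_cos (a ξ : ℝ) : deriv (fun x => a * Real.cos (ξ * x)) =
    fun x => -(ξ * a) * Real.sin (ξ * x) := by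
  funext x
  refine HasDerivAt.deriv ?_
  refine ((((hasDerivAt_id x).const_mul ξ).cos).const_mul a).congr_deriv ?_
  simp only [id]; ring

lemma deriv_const_mul_sin (a ξ : ℝ) : deriv (fun x => a * Real.sin (ξ * x)) =
    fun x => ξ * a * Real.cos (ξ * x) := by
  funext x
  refine HasDerivAt.deriv ?_
  refine ((((hasDerivAt_id x).const_mul ξ).sin).const_mul a).congr_deriv ?_
  simp only [id]; ring

lemma iteratedDeriv_cos_mul (ξ : ℝ) : iteratedDeriv 2 (fun x => Real.cos (ξ * x)) =
      (fun x => -(ξ ^ 2 * Real.cos (ξ * x))) ∧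
    iteratedDeriv 4 (fun x => Real.cos (ξ * x)) = (fun x => ξ ^ 4 * Real.cos (ξ * x)) ∧
    deriv (fun x => Real.cos (ξ * x)) = (fun x => -(ξ * Real.sin (ξ * x))) := by
  have h : (fun x => Real.cos (ξ * x)) = fun x => 1 * Real.cos (ξ * x) := by simp
  rw [h]
  simp only [iteratedDeriv_succ, iteratedDeriv_zero, deriv_const_mul_cos, deriv_const_mul_sin]
  refine ⟨funext fun x => ?_, funext fun x => ?_, funext fun x => ?_⟩ <;> ring

lemma iteratedDeriv_sin_mul (ξ : ℝ) : iteratedDeriv 2 (fun x => Real.sin (ξ * x)) =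
      (fun x => -(ξ ^ 2 * Real.sin (ξ * x))) ∧
    iteratedDeriv 4 (fun x => Real.sin (ξ * x)) = (fun x => ξ ^ 4 * Real.sin (ξ * x)) ∧
    deriv (fun x => Real.sin (ξ * x)) = (fun x => ξ * Real.cos (ξ * x)) := by
  have h : (fun x => Real.sin (ξ * x)) = fun x => 1 * Real.sin (ξ * x) := by simp
  rw [h]
  simp only [iteratedDeriv_succ, iteratedDeriv_zero, deriv_const_mul_cos, deriv_const_mul_sin]
  refine ⟨funext fun x => ?_, funext fun x => ?_, funext fun x => ?_⟩ <;> ring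

namespace IsSolution

variable {u : ℝ → ℝ → ℝ}

lemma memLp_ofReal (h : IsSolution L u) {t : ℝ} (ht : 0 ≤ t) :
    MemLp (fun x => (u t x : ℂ)) 2 (periodMeasure L) := (h.memLp t ht).ofReal

lemma integrable (h : IsSolution L u) {t : ℝ} (ht : 0 ≤ t) :
    Integrable (u t) (periodMeasure L) :=
  have := isFiniteMeasure_periodMeasure L
  (h.memLp t ht).integrable (by norm_num)

lemma integrable_sq (h : IsSolution L u) {t : ℝ} (ht : 0 ≤ t) :
    Integrable (fun x => u t x ^ 2) (periodMeasure L) := (h.memLp t ht).integrable_sq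

lemma continuousOn_solCoef (h : IsSolution L u) (hL : 1 ≤ L) (k : ℤ) :
    ContinuousOn (fun t => solCoef L u t k) (Ici 0) := by
  intro t ht
  have hL0 : 0 < L := by linarith
  have h1 := memLp_of_continuous (L := L) (f := fun _ => (1 : ℂ)) continuous_const 2
  rw [ContinuousWithinAt, tendsto_iff_edist_tendsto_0]
  have hz : Tendsto (fun τ => periodNorm L 2 (fun x => u τ x - u t x) *
      eLpNorm (fun _ => (1 : ℂ)) 2 (periodMeasure L)) (𝓝[Ici 0] t) (𝓝 0) := by
    simpa using ENNReal.Tendsto.mul_const (h.continuous t ht) (Or.inr h1.eLpNorm_ne_top)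
  refine tendsto_of_tendsto_of_tendsto_of_le_of_le' tendsto_const_nhds hz
    (Eventually.of_forall fun _ => bot_le) ?_
  filter_upwards [self_mem_nhdsWithin] with τ hτ
  rw [edist_eq_enorm_sub, solCoef, solCoef, ← coef_sub hL0
    (integrable_of_memLp_two (h.memLp_ofReal hτ)) (integrable_of_memLp_two (h.memLp_ofReal ht))]
  have := enorm_coef_mul_le hL ((h.memLp_ofReal hτ).sub (h.memLp_ofReal ht)) h1 k
  simp only [Pi.sub_apply, mul_one] at this
  rw [← eLpNorm_ofReal_comp]
  simp only [Complex.ofReal_sub]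
  exact this

lemma continuousOn_sqCoef (h : IsSolution L u) (hL : 1 ≤ L) {M : ℝ≥0∞} (hM : M ≠ ⊤)
    (hu : ∀ t, 0 ≤ t → periodNorm L 2 (u t) ≤ M) (k : ℤ) :
    ContinuousOn (fun t => sqCoef L u t k) (Ici 0) := by
  intro t ht
  have hL0 : 0 < L := by linarith
  rw [ContinuousWithinAt, tendsto_iff_edist_tendsto_0]
  have hz : Tendsto (fun τ => periodNorm L 2 (fun x => u τ x - u t x) * (M + M))
      (𝓝[Ici 0] t) (𝓝 0) := by
    simpa using ENNReal.Tendsto.mul_const (b := M + M) (h.continuous t ht)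
      (Or.inr (ENNReal.add_ne_top.2 ⟨hM, hM⟩))
  refine tendsto_of_tendsto_of_tendsto_of_le_of_le' tendsto_const_nhds hz
    (Eventually.of_forall fun _ => bot_le) ?_
  filter_upwards [self_mem_nhdsWithin] with τ hτ
  have hi : ∀ t, 0 ≤ t → Integrable (fun x => ((u t x ^ 2 : ℝ) : ℂ)) (periodMeasure L) :=
    fun t ht => (h.integrable_sq ht).ofReal
  rw [edist_eq_enorm_sub, sqCoef, sqCoef, ← coef_sub hL0 (hi τ hτ) (hi t ht)]
  have e1 := enorm_coef_mul_le hL ((h.memLp_ofReal hτ).sub (h.memLp_ofReal ht))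
    ((h.memLp_ofReal hτ).add (h.memLp_ofReal ht)) k
  have e2 : (fun x => ((fun x => (u τ x : ℂ)) - fun x => (u t x : ℂ)) x *
      ((fun x => (u τ x : ℂ)) + fun x => (u t x : ℂ)) x) =
      fun x => (((u τ x ^ 2 : ℝ) : ℂ) - ((u t x ^ 2 : ℝ) : ℂ)) := by
    funext x; simp only [Pi.sub_apply, Pi.add_apply]; push_cast; ring
  rw [e2] at e1
  refine e1.trans (mul_le_mul' (le_of_eq ?_) ?_)
  · rw [← eLpNorm_ofReal_comp]
    simp only [Complex.ofReal_sub]; rfl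
  · refine (eLpNorm_add_le (h.memLp_ofReal hτ).1 (h.memLp_ofReal ht).1 (by norm_num)).trans ?_
    rw [eLpNorm_ofReal_comp, eLpNorm_ofReal_comp]
    exact add_le_add (hu τ hτ) (hu t ht)

/-- The equation for a single Fourier mode, integrated in time. -/
lemma solCoef_sub (h : IsSolution L u) (hL : 1 ≤ L) {M : ℝ≥0∞} (hM : M ≠ ⊤)
    (hu : ∀ t, 0 ≤ t → periodNorm L 2 (u t) ≤ M) (k : ℤ) {t : ℝ} (ht : 0 ≤ t) :
    solCoef L u t k - solCoef L u 0 k = ∫ τ in (0 : ℝ)..t,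
      (-(rate L k : ℂ) * solCoef L u τ k - Complex.I * freq L k / 2 * sqCoef L u τ k) := by
  have hL0 : 0 < L := by linarith
  set ξ := freq L k with hξ
  have hper : ∀ x, ξ * (x + 2 * L) = ξ * x + k * (2 * Real.pi) := fun x => by
    rw [hξ, freq]; field_simp
  have hic : IntervalIntegrable (fun τ => -(rate L k : ℂ) * solCoef L u τ k -
      Complex.I * ξ / 2 * sqCoef L u τ k) volume 0 t := by
    refine ContinuousOn.intervalIntegrable ?_
    rw [uIcc_of_le ht]
    exact ((continuousOn_const.mul (h.continuousOn_solCoef hL k)).sub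
      (continuousOn_const.mul (h.continuousOn_sqCoef hL hM hu k))).mono fun x hx => hx.1
  have hcos := h.equation (fun x => Real.cos (ξ * x)) (by fun_prop)
    (fun x => by simp only [hper, Real.cos_add_int_mul_two_pi]) t ht
  have hsin := h.equation (fun x => Real.sin (ξ * x)) (by fun_prop)
    (fun x => by simp only [hper, Real.sin_add_int_mul_two_pi]) t ht
  obtain ⟨c2, c4, c1⟩ := iteratedDeriv_cos_mul ξ
  obtain ⟨s2, s4, s1⟩ := iteratedDeriv_sin_mul ξ
  rw [c2, c4, c1] at hcos
  rw [s2, s4, s1] at hsin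
  have hX := fun τ (hτ : 0 ≤ τ) => coef_ofReal hL0 (h.integrable hτ) k
  have hX2 := fun τ (hτ : 0 ≤ τ) => coef_ofReal hL0 (h.integrable_sq hτ) k
  have hr : rate L k = ξ ^ 4 - ξ ^ 2 := rfl
  -- Testing with the cosine gives the real part of the equation for the mode. The sine gives minus
  -- the imaginary part, because a coefficient pairs `u` with `e^{-iξx}`.
  have e1 : ∫ τ in (0 : ℝ)..t, ∫ x in (-L)..L, (-(u τ x * (ξ ^ 4 * Real.cos (ξ * x))) -
      u τ x * (-(ξ ^ 2 * Real.cos (ξ * x))) + u τ x ^ 2 / 2 * -(ξ * Real.sin (ξ * x))) =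
      2 * L * ∫ τ in (0 : ℝ)..t, (-(rate L k : ℂ) * solCoef L u τ k -
      Complex.I * ξ / 2 * sqCoef L u τ k).re := by
    rw [← intervalIntegral.integral_const_mul]
    refine intervalIntegral.integral_congr fun τ hτ => ?_
    rw [uIcc_of_le ht] at hτ
    obtain ⟨i1, i2, i3, i4⟩ := hX τ hτ.1
    obtain ⟨j1, j2, j3, j4⟩ := hX2 τ hτ.1
    have : ∀ x, -(u τ x * (ξ ^ 4 * Real.cos (ξ * x))) -
      u τ x * (-(ξ ^ 2 * Real.cos (ξ * x))) + u τ x ^ 2 / 2 * -(ξ * Real.sin (ξ * x)) =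
      -(rate L k) * (u τ x * Real.cos (ξ * x)) + -(ξ / 2) * (u τ x ^ 2 * Real.sin (ξ * x)) := by
      intro x; rw [hr]; ring
    simp only [this]
    rw [intervalIntegral.integral_add (i1.const_mul _) (j2.const_mul _),
      intervalIntegral.integral_const_mul, intervalIntegral.integral_const_mul, i3, j4]
    simp [solCoef, sqCoef]
    ring
  have e2 : ∫ τ in (0 : ℝ)..t, ∫ x in (-L)..L, (-(u τ x * (ξ ^ 4 * Real.sin (ξ * x))) -
      u τ x * (-(ξ ^ 2 * Real.sin (ξ * x))) + u τ x ^ 2 / 2 * (ξ * Real.cos (ξ * x))) =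
      -(2 * L) * ∫ τ in (0 : ℝ)..t, (-(rate L k : ℂ) * solCoef L u τ k -
      Complex.I * ξ / 2 * sqCoef L u τ k).im := by
    rw [← intervalIntegral.integral_const_mul]
    refine intervalIntegral.integral_congr fun τ hτ => ?_
    rw [uIcc_of_le ht] at hτ
    obtain ⟨i1, i2, i3, i4⟩ := hX τ hτ.1
    obtain ⟨j1, j2, j3, j4⟩ := hX2 τ hτ.1
    have : ∀ x, -(u τ x * (ξ ^ 4 * Real.sin (ξ * x))) -
      u τ x * (-(ξ ^ 2 * Real.sin (ξ * x))) + u τ x ^ 2 / 2 * (ξ * Real.cos (ξ * x)) =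
      -(rate L k) * (u τ x * Real.sin (ξ * x)) + (ξ / 2) * (u τ x ^ 2 * Real.cos (ξ * x)) := by
      intro x; rw [hr]; ring
    simp only [this]
    rw [intervalIntegral.integral_add (i2.const_mul _) (j1.const_mul _),
      intervalIntegral.integral_const_mul, intervalIntegral.integral_const_mul, i4, j3]
    simp [solCoef, sqCoef]
    ring
  rw [e1, (hX t ht).2.2.1, (hX 0 le_rfl).2.2.1] at hcos
  rw [e2, (hX t ht).2.2.2, (hX 0 le_rfl).2.2.2] at hsin
  have hre := Complex.reCLM.intervalIntegral_comp_comm hic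
  have him := Complex.imCLM.intervalIntegral_comp_comm hic
  simp only [Complex.reCLM_apply] at hre
  simp only [Complex.imCLM_apply] at him
  have h2L : (2 * L) ≠ 0 := by positivity
  apply Complex.ext
  · rw [← hre, Complex.sub_re]
    refine mul_left_cancel₀ h2L ?_
    rw [← hcos, mul_sub]; rfl
  · rw [← him, Complex.sub_im]
    refine mul_left_cancel₀ (neg_ne_zero.2 h2L) ?_
    rw [← hsin]; simp only [solCoef]; ring

lemma hasDerivAt_solCoef (h : IsSolution L u) (hL : 1 ≤ L) {M : ℝ≥0∞} (hM : M ≠ ⊤)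
    (hu : ∀ t, 0 ≤ t → periodNorm L 2 (u t) ≤ M) (k : ℤ) {t : ℝ} (ht : 0 < t) :
    HasDerivAt (fun τ => solCoef L u τ k)
      (-(rate L k : ℂ) * solCoef L u t k - Complex.I * freq L k / 2 * sqCoef L u t k) t := by
  have hc : ContinuousOn (fun τ => -(rate L k : ℂ) * solCoef L u τ k -
      Complex.I * freq L k / 2 * sqCoef L u τ k) (Ici 0) :=
    ((continuousOn_const.mul (h.continuousOn_solCoef hL k)).sub
      (continuousOn_const.mul (h.continuousOn_sqCoef hL hM hu k)))
  have hd := intervalIntegral.integral_hasDerivAt_right (a := 0) (b := t)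
    (ContinuousOn.intervalIntegrable (by
      rw [uIcc_of_le ht.le]; exact hc.mono fun x hx => hx.1))
    ((hc.mono Ioi_subset_Ici_self).stronglyMeasurableAtFilter isOpen_Ioi t ht)
    (hc.continuousAt (Ici_mem_nhds ht))
  refine (hd.const_add (solCoef L u 0 k)).congr_of_eventuallyEq ?_
  filter_upwards [Ioi_mem_nhds ht] with τ hτ
  rw [← h.solCoef_sub hL hM hu k (le_of_lt hτ)]
  ring

/-- Integrating factor: the derivative of `e^{-(t-τ) rate}` times the coefficient contains only the
nonlinear term. -/
lemma solCoef_duhamel (h : IsSolution L u) (hL : 1 ≤ L) {M : ℝ≥0∞} (hM : M ≠ ⊤)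
    (hu : ∀ t, 0 ≤ t → periodNorm L 2 (u t) ≤ M) {t₁ t : ℝ} (ht₁ : 0 < t₁) (ht : t₁ ≤ t)
    (k : ℤ) : solCoef L u t k =
    (Real.exp (-((t - t₁) * rate L k)) : ℝ) * solCoef L u t₁ k - ∫ τ in t₁..t,
      Complex.I * freq L k / 2 * (Real.exp (-((t - τ) * rate L k)) : ℝ) * sqCoef L u τ k := by
  have hd : ∀ τ ∈ uIcc t₁ t, HasDerivAt
      (fun τ => ((Real.exp (-((t - τ) * rate L k)) : ℝ) : ℂ) * solCoef L u τ k)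
      (-(Complex.I * freq L k / 2 * (Real.exp (-((t - τ) * rate L k)) : ℝ) * sqCoef L u τ k))
      τ := by
    intro τ hτ
    rw [uIcc_of_le ht] at hτ
    have e1 : HasDerivAt (fun τ => Real.exp (-((t - τ) * rate L k)))
        (Real.exp (-((t - τ) * rate L k)) * rate L k) τ := by
      have := (((((hasDerivAt_id τ).const_sub t).mul_const (rate L k)).neg).exp)
      refine this.congr_deriv ?_
      simp only [id, Pi.neg_apply]; ring
    refine (e1.ofReal_comp.mul (h.hasDerivAt_solCoef hL hM hu k (ht₁.trans_le hτ.1))).congr_deriv ?_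
    push_cast; ring
  have hi := intervalIntegral.integral_eq_sub_of_hasDerivAt hd (ContinuousOn.intervalIntegrable (by
    rw [uIcc_of_le ht]
    refine ContinuousOn.neg (ContinuousOn.mul (Continuous.continuousOn (by fun_prop)) ?_)
    exact (h.continuousOn_sqCoef hL hM hu k).mono fun τ hτ => ht₁.le.trans hτ.1))
  rw [intervalIntegral.integral_neg, sub_self, zero_mul, neg_zero, Real.exp_zero,
    Complex.ofReal_one, one_mul] at hi
  linear_combination -hi

end IsSolution

lemma Decays.mono {c : ℤ → ℂ} {B B' : ℝ} {n : ℕ} (h : Decays L n B c) (hB : B ≤ B') :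
    Decays L n B' c := fun k => (h k).trans (by gcongr)

/-- The nonlinear term of Duhamel's formula gains two derivatives. -/
lemma weight_mul_integral_exp_le {t₁ t : ℝ} (h1 : t₁ ≤ t) (h2 : t ≤ t₁ + 1) (k : ℤ) :
    ∫ τ in t₁..t, (1 + freq L k ^ 2) * (|freq L k| / 2 * Real.exp (-((t - τ) * rate L k))) ≤
      3 * Real.exp 1 := by
  set ξ := freq L k with hξ
  -- As `ξ² - ξ⁴/2 ≤ 1`, over unit time the rate may be replaced by `ξ⁴/2` at the cost of `e`, and
  -- `(1 + ξ²)|ξ|/2 ≤ 1 + ξ⁴`. The resulting majorant has this primitive, which increases by at most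
  -- `1 + 2`.
  have hd : ∀ τ ∈ uIcc t₁ t,
      HasDerivAt (fun τ => τ + 2 * Real.exp (-((t - τ) * (ξ ^ 4 / 2))))
      (1 + ξ ^ 4 * Real.exp (-((t - τ) * (ξ ^ 4 / 2)))) τ := fun τ _ => by
    have := (hasDerivAt_id τ).add
      ((((((hasDerivAt_id τ).const_sub t).mul_const (ξ ^ 4 / 2)).neg).exp).const_mul 2)
    refine this.congr_deriv ?_
    simp only [id, Pi.neg_apply]; ring
  have hc : Continuous fun τ => 1 + ξ ^ 4 * Real.exp (-((t - τ) * (ξ ^ 4 / 2))) := by fun_prop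
  have hi := intervalIntegral.integral_eq_sub_of_hasDerivAt hd (hc.intervalIntegrable _ _)
  have hm : ∫ τ in t₁..t, (1 + ξ ^ 2) * (|ξ| / 2 * Real.exp (-((t - τ) * rate L k))) ≤
      ∫ τ in t₁..t, Real.exp 1 * (1 + ξ ^ 4 * Real.exp (-((t - τ) * (ξ ^ 4 / 2)))) := by
    refine intervalIntegral.integral_mono_on h1
      (Continuous.intervalIntegrable (by fun_prop) _ _)
      (Continuous.intervalIntegrable (by fun_prop) _ _) fun τ hτ => ?_
    have hs0 : 0 ≤ t - τ := by linarith [hτ.2]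
    have hs1 : t - τ ≤ 1 := by linarith [hτ.1]
    have e0 : (1 + ξ ^ 2) * (|ξ| / 2) ≤ 1 + ξ ^ 4 := by
      have := sq_abs ξ
      nlinarith [sq_nonneg (|ξ| - 1), sq_nonneg (ξ ^ 2 - 1), abs_nonneg ξ, sq_nonneg ξ]
    have e1 : Real.exp (-((t - τ) * rate L k)) ≤
        Real.exp 1 * Real.exp (-((t - τ) * (ξ ^ 4 / 2))) := by
      rw [← Real.exp_add]
      refine Real.exp_le_exp.2 ?_
      have e3 : ξ ^ 2 - ξ ^ 4 / 2 ≤ 1 := by nlinarith [sq_nonneg (ξ ^ 2 - 1)]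
      have e4 : rate L k = ξ ^ 4 - ξ ^ 2 := rfl
      rw [e4]; nlinarith
    have e2 : Real.exp (-((t - τ) * (ξ ^ 4 / 2))) ≤ 1 :=
      Real.exp_le_one_iff.2 (by have : 0 ≤ (t - τ) * (ξ ^ 4 / 2) := by positivity
                                linarith)
    calc (1 + ξ ^ 2) * (|ξ| / 2 * Real.exp (-((t - τ) * rate L k)))
        = ((1 + ξ ^ 2) * (|ξ| / 2)) * Real.exp (-((t - τ) * rate L k)) := by ring
      _ ≤ (1 + ξ ^ 4) * (Real.exp 1 * Real.exp (-((t - τ) * (ξ ^ 4 / 2)))) := by gcongr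
      _ = Real.exp 1 * (Real.exp (-((t - τ) * (ξ ^ 4 / 2))) +
          ξ ^ 4 * Real.exp (-((t - τ) * (ξ ^ 4 / 2)))) := by ring
      _ ≤ _ := by gcongr
  refine hm.trans ?_
  rw [intervalIntegral.integral_const_mul, hi, sub_self, zero_mul, neg_zero, Real.exp_zero]
  have : 0 < Real.exp (-((t - t₁) * (ξ ^ 4 / 2))) := Real.exp_pos _
  nlinarith [Real.exp_pos 1]

/-- One step of the smoothing bootstrap in terms of decay of Fourier coefficients. -/
lemma exists_decays_succ {c b : ℝ → ℤ → ℂ}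
    (hduh : ∀ t₁ t, 0 < t₁ → t₁ ≤ t → ∀ k, c t k =
      (Real.exp (-((t - t₁) * rate L k)) : ℝ) * c t₁ k - ∫ τ in t₁..t,
        Complex.I * freq L k / 2 * (Real.exp (-((t - τ) * rate L k)) : ℝ) * b τ k)
    {n : ℕ} {ε B D : ℝ} (hε : 0 < ε) (hB : 0 ≤ B) (hD : 0 ≤ D)
    (hc : ∀ t, ε ≤ t → Decays L n B (c t)) (hb : ∀ t, ε ≤ t → Decays L n D (b t)) :
    ∃ B', 0 ≤ B' ∧ ∀ t, 2 * ε ≤ t → Decays L (n + 1) B' (c t) := by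
  obtain ⟨C, hC, hsym⟩ := exists_norm_symb_le 0
  set r := min 1 ε with hr
  have hr0 : 0 < r := by positivity
  have hr1 : r ≤ 1 := min_le_left _ _
  have hrε : r ≤ ε := min_le_right _ _
  have hr4 : r ^ 4 ≤ r := pow_le_of_le_one hr0.le hr1 (by norm_num)
  have hr4' : 0 < r ^ 4 := by positivity
  refine ⟨C / r ^ 2 * B + 3 * Real.exp 1 * D, by positivity, fun t ht k => ?_⟩
  set W := 1 + freq L k ^ 2 with hW
  have hW0 : 0 < W := by positivity
  have ht1 : 0 < t - r ^ 4 := by linarith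
  rw [pow_succ W n, le_div_iff₀ (by positivity), hduh (t - r ^ 4) t ht1 (by linarith) k,
    sub_sub_cancel]
  have e1 : ‖((Real.exp (-(r ^ 4 * rate L k)) : ℝ) : ℂ) * c (t - r ^ 4) k‖ * (W ^ n * W) ≤
      C / r ^ 2 * B := by
    have h1 : ‖((Real.exp (-(r ^ 4 * rate L k)) : ℝ) : ℂ)‖ * W ≤ C / r ^ 2 := by
      have h2 := hsym L r hr0 hr1 k
      rw [symb, pow_zero, one_mul, pow_zero, div_one] at h2
      rw [le_div_iff₀ (by positivity)]
      have h3 : W * r ^ 2 ≤ 1 + (r * freq L k) ^ 2 := by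
        have := pow_le_one₀ (n := 2) hr0.le hr1
        rw [hW]; nlinarith
      calc _ = ‖((Real.exp (-(r ^ 4 * rate L k)) : ℝ) : ℂ)‖ * (W * r ^ 2) := by ring
        _ ≤ C * (1 / (1 + (r * freq L k) ^ 2)) * (1 + (r * freq L k) ^ 2) := by gcongr
        _ = C := by field_simp
    have h4 := hc (t - r ^ 4) (by linarith) k
    rw [le_div_iff₀ (by positivity)] at h4
    rw [norm_mul]
    calc _ = (‖((Real.exp (-(r ^ 4 * rate L k)) : ℝ) : ℂ)‖ * W) *
          (‖c (t - r ^ 4) k‖ * W ^ n) := by ring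
      _ ≤ _ := by gcongr
  have e2 : ‖∫ τ in (t - r ^ 4)..t, Complex.I * freq L k / 2 *
      (Real.exp (-((t - τ) * rate L k)) : ℝ) * b τ k‖ * (W ^ n * W) ≤ 3 * Real.exp 1 * D := by
    have h1 := intervalIntegral.norm_integral_le_of_norm_le (μ := volume) (a := t - r ^ 4) (b := t)
      (f := fun τ => Complex.I * freq L k / 2 *
        (Real.exp (-((t - τ) * rate L k)) : ℝ) * b τ k)
      (g := fun τ => W * (|freq L k| / 2 * Real.exp (-((t - τ) * rate L k))) *
        (D / (W ^ n * W))) (by linarith)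
      (Eventually.of_forall fun τ hτ => by
        have h2 := hb τ (by linarith [hτ.1]) k
        rw [norm_mul, norm_mul, norm_div, norm_I_mul_freq, Complex.norm_ofNat, Complex.norm_real,
          Real.norm_eq_abs, Real.abs_exp]
        calc _ ≤ |freq L k| / 2 * Real.exp (-((t - τ) * rate L k)) * (D / W ^ n) := by gcongr
          _ = _ := by field_simp)
      (Continuous.intervalIntegrable (by fun_prop) _ _)
    rw [intervalIntegral.integral_mul_const] at h1
    have h3 := weight_mul_integral_exp_le (L := L) (t₁ := t - r ^ 4) (t := t) (by linarith)
      (by linarith) k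
    have h4 := h1.trans (mul_le_mul_of_nonneg_right h3 (by positivity))
    rw [mul_div_assoc', le_div_iff₀ (by positivity)] at h4
    exact h4
  calc _ ≤ (‖((Real.exp (-(r ^ 4 * rate L k)) : ℝ) : ℂ) * c (t - r ^ 4) k‖ +
        ‖∫ τ in (t - r ^ 4)..t, Complex.I * freq L k / 2 *
          (Real.exp (-((t - τ) * rate L k)) : ℝ) * b τ k‖) * (W ^ n * W) := by
        gcongr; exact norm_sub_le _ _
    _ ≤ _ := by rw [add_mul]; exact add_le_add e1 e2

lemma eLpNorm_two_sq (hL : 0 < L) {f : ℝ → ℂ} (hf : MemLp f 2 (periodMeasure L)) :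
    eLpNorm f 2 (periodMeasure L) ^ 2 = ENNReal.ofReal (∫ x in (-L)..L, ‖f x‖ ^ 2) := by
  rw [hf.eLpNorm_eq_integral_rpow_norm (by norm_num) (by norm_num),
    intervalIntegral.integral_of_le (by linarith), ← ENNReal.ofReal_pow (by positivity)]
  congr 1
  have h0 : 0 ≤ ∫ x, ‖f x‖ ^ 2 ∂(periodMeasure L) := integral_nonneg fun x => by positivity
  have h1 : (2 : ℝ≥0∞).toReal = 2 := by norm_num
  rw [h1]
  simp only [Real.rpow_two]
  rw [inv_eq_one_div, ← Real.sqrt_eq_rpow, Real.sq_sqrt h0]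
  rfl

/-- Parseval's identity, as an upper bound for finite sums. -/
lemma sum_sq_coef_le (hL : 0 < L) {f : ℝ → ℂ} (hf : MemLp f 2 (periodMeasure L)) {M : ℝ}
    (hM0 : 0 ≤ M) (hM : eLpNorm f 2 (periodMeasure L) ≤ ENNReal.ofReal M) (S : Finset ℤ) :
    ∑ k ∈ S, ‖coef L f k‖ ^ 2 ≤ (M / √(2 * L)) ^ 2 := by
  refine (sum_sq_le_of_hasSum (hasSum_sq_coef hL hf) S).trans ?_
  have h1 : eLpNorm f 2 (periodMeasure L) ^ 2 ≤ ENNReal.ofReal M ^ 2 := by gcongr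
  rw [eLpNorm_two_sq hL hf, ← ENNReal.ofReal_pow hM0,
    ENNReal.ofReal_le_ofReal_iff (by positivity)] at h1
  rw [div_pow, Real.sq_sqrt (by positivity), inv_mul_eq_div]
  gcongr

namespace IsSolution

variable {u : ℝ → ℝ → ℝ}

lemma exists_solCoef_bounded (h : IsSolution L u) (hL : 1 ≤ L) {M : ℝ≥0∞} (hM : M ≠ ⊤)
    (hu : ∀ t, 0 ≤ t → periodNorm L 2 (u t) ≤ M) : ∃ B, 0 ≤ B ∧ ∀ t, 0 ≤ t →
      Decays L 0 B (solCoef L u t) ∧ Decays L 0 B (sqCoef L u t) := by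
  have h1 := memLp_of_continuous (L := L) (f := fun _ => (1 : ℂ)) continuous_const 2
  set N := eLpNorm (fun _ => (1 : ℂ)) 2 (periodMeasure L)
  have hN : N ≠ ⊤ := h1.eLpNorm_ne_top
  have hT : M * N + M * M ≠ ⊤ :=
    ENNReal.add_ne_top.2 ⟨ENNReal.mul_ne_top hM hN, ENNReal.mul_ne_top hM hM⟩
  have key : ∀ z : ℂ, ‖z‖ₑ ≤ M * N + M * M → ‖z‖ ≤ (M * N + M * M).toReal := fun z hz => by
    rw [← toReal_enorm]; exact ENNReal.toReal_mono hT hz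
  refine ⟨(M * N + M * M).toReal, ENNReal.toReal_nonneg, fun t ht => ⟨fun k => ?_, fun k => ?_⟩⟩ <;>
    rw [pow_zero, div_one] <;> refine key _ ?_
  · have := enorm_coef_mul_le hL (h.memLp_ofReal ht) h1 k
    simp only [mul_one] at this
    refine (this.trans (mul_le_mul' ?_ le_rfl)).trans le_self_add
    rw [eLpNorm_ofReal_comp]; exact hu t ht
  · have := enorm_coef_mul_le hL (h.memLp_ofReal ht) (h.memLp_ofReal ht) k
    have e : (fun x => (u t x : ℂ) * (u t x : ℂ)) = fun x => ((u t x ^ 2 : ℝ) : ℂ) := by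
      funext x; push_cast; ring
    rw [e] at this
    refine (this.trans (mul_le_mul' ?_ ?_)).trans le_add_self <;>
      rw [eLpNorm_ofReal_comp] <;> exact hu t ht

lemma ae_eq_synth (h : IsSolution L u) (hL : 1 ≤ L) {t : ℝ} (ht : 0 ≤ t)
    (hs : Summable fun k => ‖solCoef L u t k‖) :
    (fun x => (u t x : ℂ)) =ᵐ[periodMeasure L] synth L (solCoef L u t) :=
  ae_eq_synth_coef (by linarith) (h.memLp_ofReal ht) hs

lemma sqCoef_eq_conv (h : IsSolution L u) (hL : 1 ≤ L) {t : ℝ} (ht : 0 ≤ t)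
    (hs : Summable fun k => ‖solCoef L u t k‖) :
    sqCoef L u t = conv (solCoef L u t) (solCoef L u t) := by
  have hL0 : 0 < L := by linarith
  funext k
  rw [← coef_synth hL0 (summable_conv hs hs) k]
  refine coef_congr_ae hL0 ?_ k
  filter_upwards [h.ae_eq_synth hL ht hs] with x hx
  rw [synth_conv hs hs, ← hx]
  push_cast; ring

/-- A solution is smooth for positive times. -/
theorem spectralSolution (h : IsSolution L u) (hL : 1 ≤ L) {M : ℝ≥0∞} (hM : M ≠ ⊤)
    (hu : ∀ t, 0 ≤ t → periodNorm L 2 (u t) ≤ M) :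
    SpectralSolution L (solCoef L u) (sqCoef L u) := by
  obtain ⟨B₀, hB₀, hB⟩ := h.exists_solCoef_bounded hL hM hu
  have hcont := fun k => h.continuousOn_sqCoef hL hM hu k
  have hduh : ∀ t₁ t, 0 < t₁ → t₁ ≤ t → ∀ k, solCoef L u t k =
      (Real.exp (-((t - t₁) * rate L k)) : ℝ) * solCoef L u t₁ k - ∫ τ in t₁..t,
        Complex.I * freq L k / 2 * (Real.exp (-((t - τ) * rate L k)) : ℝ) * sqCoef L u τ k :=
    fun t₁ t h1 h2 k => h.solCoef_duhamel hL hM hu h1 h2 k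
  -- The first gain uses only boundedness of the coefficients of `u` and `u²`. It already makes the
  -- series of `u` absolutely convergent, which is what allows the coefficients of `u²` to be
  -- identified with a convolution.
  have hone : ∀ ε : ℝ, 0 < ε → ∃ B, 0 ≤ B ∧ ∀ t, ε ≤ t → Decays L 1 B (solCoef L u t) := by
    intro ε hε
    obtain ⟨B', hB', hd⟩ := exists_decays_succ hduh (half_pos hε) hB₀ hB₀
      (fun t ht => (hB t (by linarith)).1) (fun t ht => (hB t (by linarith)).2)
    exact ⟨B', hB', fun t ht => hd t (by linarith)⟩
  have hconv : ∀ t, 0 < t → sqCoef L u t = conv (solCoef L u t) (solCoef L u t) := by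
    intro t ht
    obtain ⟨B, -, hd⟩ := hone t ht
    exact h.sqCoef_eq_conv hL ht.le ((hd t le_rfl).summable hL)
  refine ⟨fun n => ?_, hconv, fun k => (hcont k).mono Ioi_subset_Ici_self, hduh⟩
  induction n with
  | zero => exact fun ε hε => ⟨B₀, hB₀, fun t ht => (hB t (by linarith)).1⟩
  | succ n ih =>
    intro ε hε
    -- The convolution estimate needs order at least `1`, so passing from order `0` to `1` is
    -- treated apart.
    rcases Nat.eq_zero_or_pos n with rfl | hn
    · exact hone ε hε
    obtain ⟨m, rfl⟩ : ∃ m, n = m + 1 := ⟨n - 1, by omega⟩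
    obtain ⟨B, hB0, hd⟩ := ih (ε / 2) (half_pos hε)
    obtain ⟨B', hB', hd'⟩ := exists_decays_succ hduh (half_pos hε) hB0
      (D := B * B * 4 ^ (m + 1) * (4 * L)) (by positivity) hd (fun t ht => by
        rw [hconv t (by linarith)]
        exact (hd t ht).conv hL hB0 hB0 (hd t ht))
    exact ⟨B', hB', fun t ht => hd' t (by linarith)⟩

end IsSolution

/-! ### Interpolation to fractional order and the conclusion -/

/-- Control of a fractional Sobolev norm by the `L²` norms of a function and a derivative. -/
lemma homSobolevNorm_le (hL : 0 < L) {s : ℝ} (hs : 0 ≤ s) {m : ℕ} (hm : s ≤ m) {f : ℝ → ℝ}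
    {R D : ℝ} (hR : 0 < R) (hD : 0 ≤ D)
    (h0 : ∀ S : Finset ℤ, ∑ k ∈ S, ‖coef L (fun x => (f x : ℂ)) k‖ ^ 2 ≤ D ^ 2 / (2 * L))
    (h1 : ∀ S : Finset ℤ, ∑ k ∈ S, ‖dmul L m (coef L fun x => (f x : ℂ)) k‖ ^ 2 ≤
      (R ^ m * D) ^ 2 / (2 * L)) :
    homSobolevNorm L s f ≤ ENNReal.ofReal (2 * (R ^ s * D)) := by
  have hcoef : ∀ k, fourierCoef L f k = (√(2 * L) : ℝ) * coef L (fun x => (f x : ℂ)) k := by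
    intro k
    have e1 : ∀ x : ℝ, Complex.exp (-(Real.pi * Complex.I * k * x / L)) = wave L (-k) x := by
      intro x
      rw [wave, freq]; congr 1; push_cast; ring
    rw [fourierCoef, coef]
    simp only [e1]
    rw [← mul_assoc, ← Complex.ofReal_mul]
    congr 2
    rw [← div_eq_mul_inv, Real.sqrt_div_self, one_div]
  have hterm : ∀ k : ℤ, ‖fourierCoef L f k‖ₑ ^ 2 * ENNReal.ofReal ((|(k : ℝ)| / L) ^ (2 * s)) ≤
      ENNReal.ofReal (2 * L * R ^ (2 * s) * (‖coef L (fun x => (f x : ℂ)) k‖ ^ 2 +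
        ‖dmul L m (coef L fun x => (f x : ℂ)) k‖ ^ 2 / (R ^ m) ^ 2)) := by
    intro k
    set z := coef L (fun x => (f x : ℂ)) k
    rw [hcoef, ← ofReal_norm, ← ENNReal.ofReal_pow (norm_nonneg _),
      ← ENNReal.ofReal_mul (by positivity)]
    refine ENNReal.ofReal_le_ofReal ?_
    rw [norm_mul, mul_pow, Complex.norm_real, Real.norm_of_nonneg (Real.sqrt_nonneg _),
      Real.sq_sqrt (by positivity)]
    have hd : ‖dmul L m (coef L fun x => (f x : ℂ)) k‖ ^ 2 =
        (|freq L k| ^ m) ^ 2 * ‖z‖ ^ 2 := by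
      rw [dmul, norm_mul, norm_pow, norm_I_mul_freq, mul_pow]
    rw [hd]
    set y := |freq L k| with hy
    have hy0 : 0 ≤ y := abs_nonneg _
    have hky : |(k : ℝ)| / L ≤ y := by
      rw [hy, freq, abs_div, abs_mul, abs_of_pos Real.pi_pos, abs_of_pos hL]
      have := Real.pi_gt_three
      gcongr
      nlinarith [abs_nonneg (k : ℝ)]
    have h2 : (|(k : ℝ)| / L) ^ (2 * s) ≤ y ^ (2 * s) := by gcongr
    -- Interpolation at the frequency `R`: with `w = y/R`, the power `w^(2s)` is at most `1` for `w
    -- ≤ 1` and at most `w^(2m)` otherwise.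
    have h3 : y ^ (2 * s) ≤ R ^ (2 * s) * (1 + (y ^ m) ^ 2 / (R ^ m) ^ 2) := by
      have e1 : y ^ (2 * s) = R ^ (2 * s) * (y / R) ^ (2 * s) := by
        rw [← Real.mul_rpow hR.le (by positivity), mul_div_cancel₀ _ hR.ne']
      rw [e1, ← div_pow, ← div_pow]
      refine mul_le_mul_of_nonneg_left ?_ (by positivity)
      set w := y / R
      have hw : 0 ≤ w := by positivity
      rcases le_total w 1 with h | h
      · have := Real.rpow_le_one hw h (by positivity : 0 ≤ 2 * s)
        have : 0 ≤ (w ^ m) ^ 2 := by positivity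
        linarith
      · have e2 : w ^ (2 * s) ≤ w ^ (((m * 2 : ℕ) : ℝ)) :=
          Real.rpow_le_rpow_of_exponent_le h (by push_cast; linarith)
        rw [Real.rpow_natCast, pow_mul] at e2
        linarith
    calc 2 * L * ‖z‖ ^ 2 * (|(k : ℝ)| / L) ^ (2 * s)
        ≤ 2 * L * ‖z‖ ^ 2 * (R ^ (2 * s) * (1 + (y ^ m) ^ 2 / (R ^ m) ^ 2)) :=
          mul_le_mul_of_nonneg_left (h2.trans h3) (by positivity)
      _ = _ := by ring
  have hsum : ∑' k : ℤ, ‖fourierCoef L f k‖ₑ ^ 2 * ENNReal.ofReal ((|(k : ℝ)| / L) ^ (2 * s)) ≤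
      ENNReal.ofReal ((2 * (R ^ s * D)) ^ 2) := by
    rw [ENNReal.tsum_eq_iSup_sum]
    refine iSup_le fun S => (Finset.sum_le_sum fun k _ => hterm k).trans ?_
    rw [← ENNReal.ofReal_sum_of_nonneg fun k _ => by positivity]
    refine ENNReal.ofReal_le_ofReal ?_
    rw [← Finset.mul_sum, Finset.sum_add_distrib, ← Finset.sum_div]
    have e0 := h0 S
    have e1 := h1 S
    have e2 : R ^ (2 * s) = (R ^ s) ^ 2 := by
      rw [mul_comm, Real.rpow_mul hR.le, Real.rpow_two]
    rw [e2]
    calc _ ≤ 2 * L * (R ^ s) ^ 2 * (D ^ 2 / (2 * L) +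
          (R ^ m * D) ^ 2 / (2 * L) / (R ^ m) ^ 2) := by gcongr
      _ = 2 * (R ^ s * D) ^ 2 := by field_simp; ring
      _ ≤ _ := by nlinarith [sq_nonneg (R ^ s * D)]
  rw [homSobolevNorm]
  calc _ ≤ ENNReal.ofReal ((2 * (R ^ s * D)) ^ 2) ^ (1 / 2 : ℝ) := by gcongr
    _ = _ := by
      rw [ENNReal.ofReal_rpow_of_nonneg (by positivity) (by norm_num), ← Real.sqrt_eq_rpow,
        Real.sqrt_sq (by positivity)]

namespace IsSolution

variable {u : ℝ → ℝ → ℝ}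

/-- For `s = 0` the Sobolev norm is controlled by the `L²` norm, without any smoothing. -/
lemma sobolevNorm_zero_le (h : IsSolution L u) (hL : 1 ≤ L) {H t : ℝ} (hH : 0 ≤ H) (ht : 0 ≤ t)
    (hu : periodNorm L 2 (u t) ≤ ENNReal.ofReal H) :
    sobolevNorm L 0 (u t) ≤ ENNReal.ofReal (3 * H) := by
  have hL0 : 0 < L := by linarith
  have hS : ∀ S : Finset ℤ, ∑ k ∈ S, ‖coef L (fun x => (u t x : ℂ)) k‖ ^ 2 ≤ H ^ 2 / (2 * L) := by
    intro S
    have := sum_sq_coef_le hL0 (h.memLp_ofReal ht) hH (by rw [eLpNorm_ofReal_comp]; exact hu) S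
    rwa [div_pow, Real.sq_sqrt (by positivity)] at this
  have h1 := homSobolevNorm_le hL0 le_rfl (m := 0) (by simp) one_pos hH hS
    (by simpa only [dmul_zero, one_pow, one_mul] using hS)
  rw [sobolevNorm]
  refine (add_le_add hu h1).trans ?_
  rw [← ENNReal.ofReal_add hH (by positivity), Real.one_rpow]
  exact ENNReal.ofReal_le_ofReal (by linarith)

lemma periodNorm_eq_zero (h : IsSolution L u) {t : ℝ} (ht : 0 ≤ t)
    (h0 : periodNorm L 2 (u t) = 0) (p : ℝ≥0∞) : periodNorm L p (u t) = 0 := by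
  rw [periodNorm, eLpNorm_eq_zero_iff (h.memLp t ht).1 (by norm_num)] at h0
  rw [periodNorm, eLpNorm_congr_ae h0, eLpNorm_zero]

/-- The main estimate, in terms of an inverse length `R` for which `‖u(t)‖_{L^p} ≤ R^{3-1/p}`. -/
theorem exists_sobolevNorm_le {s : ℝ} (hs : 0 ≤ s) {p : ℝ≥0∞} (hp : 1 ≤ p) {δ : ℝ} (hδ : 0 < δ) :
    ∃ C : ℝ, 1 ≤ C ∧ ∀ L : ℝ, 1 ≤ L → ∀ u : ℝ → ℝ → ℝ, IsSolution L u → ∀ R H : ℝ, 1 ≤ R → 0 ≤ H →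
      (∀ t, 0 ≤ t → periodNorm L 2 (u t) ≤ ENNReal.ofReal H) →
      (∀ t, 0 < t → periodNorm L p (u t) ≤ ENNReal.ofReal (R ^ (3 - (1 / p).toReal))) →
      ∀ t, δ ≤ t → sobolevNorm L s (u t) ≤ ENNReal.ofReal (C * R ^ s * H) := by
  obtain ⟨C₀, hC₀, hsup⟩ := SpectralSolution.exists_norm_synth_le hp (half_pos hδ)
  set m := ⌈s⌉₊ with hm
  -- The time `δ` is split: sup bounds hold from `δ/2` on, and derivative bounds after a further
  -- `δ/2`.
  obtain ⟨C₁, hC₁, hsum⟩ := SpectralSolution.exists_sum_sq_dmul_le hC₀ m (δ / 2) (half_pos hδ)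
  set D := max 1 C₁ with hD
  have hD1 : 1 ≤ D := le_max_left _ _
  refine ⟨1 + 2 * D, by linarith, fun L hL u h R H hR hH hu hK t ht => ?_⟩
  have hL0 : 0 < L := by linarith
  have hsol := h.spectralSolution hL ENNReal.ofReal_ne_top hu
  have hsq : ∀ t, 0 ≤ t → ∀ S : Finset ℤ,
      ∑ k ∈ S, ‖solCoef L u t k‖ ^ 2 ≤ (H / √(2 * L)) ^ 2 := fun t ht S =>
    sum_sq_coef_le hL0 (h.memLp_ofReal ht) hH (by rw [eLpNorm_ofReal_comp]; exact hu t ht) S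
  have hbd := hsup L _ _ hL hsol R hR fun t ht => by
    rw [← eLpNorm_congr_ae (h.ae_eq_synth hL ht.le ((hsol.rapid ht).summable hL)),
      eLpNorm_ofReal_comp]
    exact hK t ht
  have hder := hsum L _ _ hL hsol R (δ / 2) (H / √(2 * L)) hR (half_pos hδ) (by positivity) hbd
    (fun t ht => hsq t (by linarith)) m le_rfl t (by linarith)
  have ht0 : 0 ≤ t := by linarith
  have hhom := homSobolevNorm_le hL0 hs (m := m) (Nat.le_ceil s) (f := u t) (R := R) (D := D * H)
    (by linarith) (by positivity)
    (fun S => by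
      refine (hsq t ht0 S).trans ?_
      rw [div_pow, Real.sq_sqrt (by positivity)]
      gcongr
      exact le_mul_of_one_le_left hH hD1)
    (fun S => by
      refine (hder S).trans ?_
      have e : (C₁ * R ^ m * (H / √(2 * L))) ^ 2 = (R ^ m * (C₁ * H)) ^ 2 / (2 * L) := by
        rw [show C₁ * R ^ m * (H / √(2 * L)) = R ^ m * (C₁ * H) / √(2 * L) by ring, div_pow,
          Real.sq_sqrt (by positivity)]
      rw [e]
      gcongr
      exact le_max_right _ _)
  rw [sobolevNorm]
  refine (add_le_add (hu t ht0) hhom).trans ?_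
  rw [← ENNReal.ofReal_add hH (by positivity)]
  refine ENNReal.ofReal_le_ofReal ?_
  have hRs : 1 ≤ R ^ s := Real.one_le_rpow hR hs
  nlinarith [mul_le_mul_of_nonneg_right hRs hH]

end IsSolution

end KuramotoSivashinsky

theorem mainTheorem4 (s : ℝ) (hs : 0 ≤ s) (p : ℝ≥0∞) (hp : 1 ≤ p) (δ : ℝ) (hδ : 0 < δ) :
    ∃ C : ℝ≥0, ∀ L : ℝ, 1 ≤ L → ∀ u : ℝ → ℝ → ℝ, KuramotoSivashinsky.IsSolution L u →
      (⨆ t : ℝ, ⨆ _ : δ ≤ t, KuramotoSivashinsky.sobolevNorm L s (u t)) ≤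
        (C : ℝ≥0∞) * (max 1 (KuramotoSivashinsky.periodNormSup L p u)) ^ (s / (3 - (1 / p).toReal)) *
          KuramotoSivashinsky.energySup L u := by
  obtain ⟨C, hC1, hC⟩ := KuramotoSivashinsky.IsSolution.exists_sobolevNorm_le hs hp hδ
  have he1 := KuramotoSivashinsky.toReal_one_div_le_one hp
  set e := (1 / p).toReal
  -- The `3` serves the case `s = 0`; it also keeps the constant nonzero, so that an infinite `H`
  -- makes the right-hand side infinite.
  refine ⟨(max 3 C).toNNReal, fun L hL u h => iSup₂_le fun t ht => ?_⟩
  set K := KuramotoSivashinsky.periodNormSup L p u with hK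
  set H := KuramotoSivashinsky.energySup L u with hH
  have hCC : ((max 3 C).toNNReal : ℝ≥0∞) = ENNReal.ofReal (max 3 C) := rfl
  rw [hCC]
  have hC0 : ENNReal.ofReal (max 3 C) ≠ 0 := by
    rw [Ne, ENNReal.ofReal_eq_zero, not_le]; positivity
  have hx : 0 ≤ s / (3 - e) := div_nonneg hs (by linarith)
  have hKx : (max 1 K) ^ (s / (3 - e)) ≠ 0 :=
    (zero_lt_one.trans_le ((ENNReal.one_rpow _).symm.trans_le
      (ENNReal.rpow_le_rpow (le_max_left _ _) hx))).ne'
  by_cases hHt : H = ⊤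
  · rw [hHt, ENNReal.mul_top (mul_ne_zero hC0 hKx)]
    exact le_top
  have hHle : ∀ t, 0 ≤ t → KuramotoSivashinsky.periodNorm L 2 (u t) ≤ H := fun t ht =>
    le_iSup₂ (f := fun t (_ : 0 ≤ t) => KuramotoSivashinsky.periodNorm L 2 (u t)) t ht
  have hHr : ENNReal.ofReal H.toReal = H := ENNReal.ofReal_toReal hHt
  have ht0 : 0 ≤ t := by linarith
  -- For `s = 0` the power of `K` is `1` even when `K = ⊤`, so the claim has content there and is
  -- proved by Parseval, without smoothing.
  rcases hs.eq_or_lt with rfl | hs0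
  · rw [zero_div, ENNReal.rpow_zero, mul_one]
    refine (h.sobolevNorm_zero_le hL (H := H.toReal) ENNReal.toReal_nonneg ht0
      (by rw [hHr]; exact hHle t ht0)).trans ?_
    rw [ENNReal.ofReal_mul (by norm_num), hHr]
    gcongr
    exact le_max_left _ _
  by_cases hKt : K = ⊤
  · have hH0 : H ≠ 0 := by
      intro hH0
      have : K = 0 := by
        refine le_antisymm (iSup₂_le fun τ hτ => ?_) bot_le
        have h0 := le_antisymm ((hHle τ hτ.le).trans hH0.le) bot_le
        exact (h.periodNorm_eq_zero hτ.le h0 p).le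
      rw [this] at hKt
      exact ENNReal.zero_ne_top hKt
    rw [hKt, max_eq_right le_top, ENNReal.top_rpow_of_pos (div_pos hs0 (by linarith)),
      ENNReal.mul_top hC0, ENNReal.top_mul hH0]
    exact le_top
  have hMt : max 1 K ≠ ⊤ := by simp [hKt]
  set M := (max 1 K).toReal with hM
  have hMr : ENNReal.ofReal M = max 1 K := ENNReal.ofReal_toReal hMt
  have hM1 : 1 ≤ M := by
    have := ENNReal.toReal_mono hMt (le_max_left 1 K)
    simpa using this
  have hM0 : 0 < M := by linarith
  -- The inverse length is `R = M^(1/(3-e))`, so that `R^(3-e) = M` bounds the `L^p` norms and `R^s`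
  -- is the required power of `M`.
  have hR := Real.one_le_rpow hM1 (by
    have : 0 < 3 - e := by linarith
    positivity : 0 ≤ 1 / (3 - e))
  have hpow : (M ^ (1 / (3 - e))) ^ (3 - e) = M := by
    rw [← Real.rpow_mul hM0.le, one_div_mul_cancel (by linarith), Real.rpow_one]
  have hfin := hC L hL u h (M ^ (1 / (3 - e))) H.toReal hR ENNReal.toReal_nonneg
    (fun t ht => by rw [hHr]; exact hHle t ht)
    (fun t ht => by
      rw [hpow, hMr]
      exact (le_iSup₂ (f := fun t (_ : 0 < t) => KuramotoSivashinsky.periodNorm L p (u t))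
        t ht).trans (le_max_right _ _)) t ht
  refine hfin.trans ?_
  rw [← Real.rpow_mul hM0.le, one_div_mul_eq_div, ENNReal.ofReal_mul (by positivity),
    ENNReal.ofReal_mul (by linarith), hHr, ← ENNReal.ofReal_rpow_of_pos hM0, hMr]
  gcongr
  exact le_max_right _ _
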